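/- \textbf{Definitions.} Let $H$ be a finite undirected graph. An \emph{acyclic moral orientation} (AMO) of $H$ is an orientation of all edges of $H$ that has no directed cycle and no induced subgraph $a\to b\leftarrow c$; $\#\mathrm{AMO}(H)$ is the number of AMOs of $H$. A linear ordering $\tau$ of $V_H$ \emph{represents} an AMO $\alpha$ if $u$ precedes $v$ in $\tau$ for every edge $u\to v$ of $\alpha$. For a clique $K$ of $H$ and a permutation $\pi$ of $K$, let $H^{\pi(K)}$ be the union of all AMOs of $H$ that are represented by some ordering beginning with $\pi$, and let $H^K=\bigcup_\pi H^{\pi(K)}$ (an edge is undirected in a union if both of its directions occur). Let $\mathcal C_H(K)$ be the set of undirected connected components of $H^K[V_H\setminus K]$, i.e. the connected components of the graph formed by its vertices and its undirected edges. For a set $S$ and a collection $R$ of sets, $\phi(S,R)$ is the number of permutations of $S$ no initial segment of which has an element of $R$ as its underlying set. A \emph{rooted clique tree} of $H$ is a triple $\mathcal T=(T,r,\iota)$, where $T$ is a tree with root $r$ and $\iota$ is a bijection from the nodes of $T$ to the maximal cliques of $H$ such that $\{x : v\in\iota(x)\}$ is connected in $T$ for every $v\in V_H$. If $r=x_1,\dots,x_p=v$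 is the path from $r$ to $v$ in $T$, then $\mathrm{FP}(v,\mathcal T)$ is the set of those $\iota(x_i)\cap\iota(x_{i+1})$, $1\le i<p$, that are contained in $\iota(v)$. \textbf{Algorithm (Clique-Picking).} The recursive function $\mathtt{count}(H)$ uses a table $\mathrm{memo}$, which is shared by all calls and initially empty. If $H\in\mathrm{memo}$, return $\mathrm{memo}[H]$. Otherwise take any rooted clique tree $\mathcal T=(T,r,\iota)$ of $H$, set $\mathrm{sum}\leftarrow 0$, and let $Q$ be the queue with the single element $r$. While $Q$ is not empty: pop $v$ from $Q$; push the children of $v$ in $T$ to $Q$; set $\mathrm{prod}\leftarrow 1$; for each $C\in\mathcal C_H(\iota(v))$ set $\mathrm{prod}\leftarrow\mathrm{prod}\cdot\mathtt{count}(C)$; set $\mathrm{sum}\leftarrow\mathrm{sum}+\phi(\iota(v),\mathrm{FP}(v,\mathcal T))\cdot\mathrm{prod}$. Finally set $\mathrm{memo}[H]\leftarrow\mathrm{sum}$ and return $\mathrm{sum}$. \textbf{Theorem.} Let $G$ be a finite undirected connected chordal graph (no set of four or more vertices induces a cycle). Then $\mathtt{count}(G)$, started with the empty table, terminates and returns $\#\mathrm{AMO}(G)$.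 This holds for every choice of the rooted clique trees and of the orders in which children and components are processed; in particular, every rooted clique tree that the algorithm needs exists. -/

import Mathlib

universe u

namespace CliquePicking

/-- A graph is chordal if no set of four or more vertices induces a cycle. -/
def IsChordal {V : Type u} (G : SimpleGraph V) : Prop :=
  ∀ n : ℕ, 4 ≤ n → ¬ (SimpleGraph.cycleGraph n).IsIndContained G

/-! ### Acyclic moral orientations

Partially directed graphs are digraphs: an edge `u - v` is undirected if both `(u, v)` and `(v, u)`
are present, and directed if exactly one of them is. The union of graphs is the supremum. -/

/-- `α` is an orientation of the undirected graph `G`: every edge of `G` is replaced by exactly one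
of its two directions, and there are no other edges. -/
def IsOrientation {V : Type u} (G : SimpleGraph V) (α : Digraph V) : Prop :=
  (∀ u v, G.Adj u v ↔ α.Adj u v ∨ α.Adj v u) ∧ ∀ u v, α.Adj u v → ¬ α.Adj v u

/-- `α` has no directed cycle. -/
def IsAcyclic {V : Type u} (α : Digraph V) : Prop :=
  ∀ v, ¬ Relation.TransGen α.Adj v v

/-- `α` has no v-structure, i.e. no induced subgraph `a → b ← c` with `a ≠ c`. -/
def IsMoral {V : Type u} (α : Digraph V) : Prop :=
  ∀ a b c, a ≠ c → α.Adj a b → α.Adj c b → α.Adj a c ∨ α.Adj c a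

/-- `α` is an acyclic moral orientation (AMO) of `G`. -/
structure IsAMO {V : Type u} (G : SimpleGraph V) (α : Digraph V) : Prop where
  orientation : IsOrientation G α
  acyclic : IsAcyclic α
  moral : IsMoral α

/-- The number of AMOs of `G`. -/
noncomputable def numAMO {V : Type u} (G : SimpleGraph V) : ℕ :=
  {α : Digraph V | IsAMO G α}.ncard

/-! ### Orderings, `G^{π(K)}`, `G^K` and `𝒞_G(K)`

All graphs handled by the algorithm are subgraphs `H` of the input graph `G`; the type `G.Subgraph`
records the vertex set and the edge set of such a graph. -/

/-- The list `l` is a permutation (linear ordering) of the set `S`. -/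
def IsPermOf {V : Type u} (l : List V) (S : Set V) : Prop :=
  l.Nodup ∧ {x | x ∈ l} = S

/-- `τ` is a topological ordering of the vertices of `H` which represents `α`: no edge of `α` goes
from a later to an earlier vertex. -/
def Represents {V : Type u} {G : SimpleGraph V} (H : G.Subgraph) (τ : List V) (α : Digraph V) :
    Prop :=
  IsPermOf τ H.verts ∧ τ.Pairwise fun a b => ¬ α.Adj b a

/-- The `π`-orientation of `H`, where `π` is a permutation of a clique: the union of all AMOs of `H`
which are represented by a topological ordering that begins with `π`. -/
def permOrientation {V : Type u} {G : SimpleGraph V} (H : G.Subgraph) (π : List V) : Digraph V :=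
  sSup {α | IsAMO H.spanningCoe α ∧ ∃ τ, Represents H τ α ∧ π <+: τ}

/-- `H^K`, the union of the `π`-orientations over all permutations `π` of `K`. -/
def cliqueOrientation {V : Type u} {G : SimpleGraph V} (H : G.Subgraph) (K : Set V) : Digraph V :=
  sSup {D | ∃ π, IsPermOf π K ∧ D = permOrientation H π}

theorem cliqueOrientation_adj_sub {V : Type u} {G : SimpleGraph V} (H : G.Subgraph) (K : Set V)
    {a b : V} (h : (cliqueOrientation H K).Adj a b) : H.Adj a b := by
  obtain ⟨_, ⟨π, -, rfl⟩, α, ⟨hα, -⟩, hab⟩ := h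
  exact (hα.orientation.1 a b).2 (Or.inl hab)

/-- The undirected part of the induced subgraph `H^K[V_H ∖ K]`. -/
def undirectedPart {V : Type u} {G : SimpleGraph V} (H : G.Subgraph) (K : Set V) :
    G.Subgraph where
  verts := H.verts \ K
  Adj a b := a ∈ H.verts \ K ∧ b ∈ H.verts \ K ∧
    (cliqueOrientation H K).Adj a b ∧ (cliqueOrientation H K).Adj b a
  adj_sub h := (cliqueOrientation_adj_sub H K h.2.2.1).adj_sub
  edge_vert h := h.1
  symm := ⟨fun _ _ h => ⟨h.2.1, h.1, h.2.2.2, h.2.2.1⟩⟩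

/-- `𝒞_H(K)`: the undirected connected components of `H^K[V_H ∖ K]`, i.e. the maximal connected
subgraphs of its undirected part. -/
def components {V : Type u} {G : SimpleGraph V} (H : G.Subgraph) (K : Set V) : Set G.Subgraph :=
  {C | Maximal (fun C' : G.Subgraph => C' ≤ undirectedPart H K ∧ C'.Connected) C}

/-! ### The function `φ`, clique trees and forbidden prefixes -/

/-- `φ(S, R)`: the number of permutations of `S` that do not have a set in `R` as a prefix. -/
noncomputable def phi {V : Type u} (S : Set V) (R : Set (Set V)) : ℕ :=
  {l : List V | IsPermOf l S ∧ ∀ p, p <+: l → {x | x ∈ p} ∉ R}.ncard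

/-- `Π(H)`: the set of maximal cliques of `H`. -/
def maxCliques {V : Type u} {G : SimpleGraph V} (H : G.Subgraph) : Set (Set V) :=
  {K | Maximal (fun K' : Set V => K' ⊆ H.verts ∧ K'.Pairwise H.Adj) K}

/-- A rooted clique tree `(T, r, ι)` of `H`. -/
structure RootedCliqueTree {V : Type u} {G : SimpleGraph V} (H : G.Subgraph) where
  Node : Type u
  tree : SimpleGraph Node
  isTree : tree.IsTree
  root : Node
  ι : Node → Set V
  bijOn : Set.BijOn ι Set.univ (maxCliques H)
  connected : ∀ v ∈ H.verts, (tree.induce {x | v ∈ ι x}).Connected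

/-- `w` is a child of `v` in the rooted tree. -/
def RootedCliqueTree.IsChild {V : Type u} {G : SimpleGraph V} {H : G.Subgraph}
    (T : RootedCliqueTree H) (v w : T.Node) : Prop :=
  T.tree.Adj v w ∧ T.tree.dist T.root w = T.tree.dist T.root v + 1

/-- `FP(v, T)`: the sets `ι(x) ∩ ι(y) ⊆ ι(v)` for consecutive nodes `x`, `y` on the path from the
root to `v`. -/
def RootedCliqueTree.FP {V : Type u} {G : SimpleGraph V} {H : G.Subgraph}
    (T : RootedCliqueTree H) (v : T.Node) : Set (Set V) :=
  {S | ∃ p : T.tree.Walk T.root v, p.IsPath ∧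
    ∃ d ∈ p.darts, S = T.ι d.fst ∩ T.ι d.snd ∧ S ⊆ T.ι v}

/-! ### The Clique-Picking algorithm

The recursive function `count` is given as a transition system. It is nondeterministic: the rooted
clique tree, the order in which the children of a node are pushed, and the order in which the
components are processed are arbitrary. -/

/-- The list `l` enumerates the set `s`, every element once. -/
def Enumerates {A : Type*} (l : List A) (s : Set A) : Prop :=
  l.Nodup ∧ ∀ a, a ∈ l ↔ a ∈ s

/-- The table of stored results; it is shared by all calls of `count`. -/
abbrev Memo {V : Type u} (G : SimpleGraph V) : Type u := G.Subgraph → Option ℕ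

/-- The local variables of a call of `count` that are alive during the whole `while` loop: the
argument, the clique tree, the variable `sum` and the queue `Q` (its head is popped first). -/
structure Frame {V : Type u} (G : SimpleGraph V) where
  graph : G.Subgraph
  T : RootedCliqueTree graph
  sum : ℕ
  queue : List T.Node

/-- A call of `count` inside the `foreach` loop for the node `node`: additionally the variable
`prod` and the list of components `H` that have not been processed yet. -/
structure LoopFrame {V : Type u} (G : SimpleGraph V) extends Frame G where
  node : T.Node
  prod : ℕ
  todo : List G.Subgraph

/-- The states of the algorithm. The stack holds the suspended calls of `count`, each of which is
waiting for the result of the recursive call in its `foreach` loop. -/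
inductive State {V : Type u} (G : SimpleGraph V)
  /-- `count H` is about to be executed. -/
  | call (H : G.Subgraph) (stack : List (LoopFrame G)) (memo : Memo G)
  /-- The test of the `while` loop. -/
  | whileLoop (f : Frame G) (stack : List (LoopFrame G)) (memo : Memo G)
  /-- The test of the `foreach` loop. -/
  | forLoop (f : LoopFrame G) (stack : List (LoopFrame G)) (memo : Memo G)
  /-- The current call of `count` has returned `n`. -/
  | ret (n : ℕ) (stack : List (LoopFrame G)) (memo : Memo G)

open Classical in
/-- One step of the algorithm. -/
inductive Step {V : Type u} {G : SimpleGraph V} : State G → State G → Prop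
  /-- `if H ∈ memo then return memo[H]` -/
  | lookup {H : G.Subgraph} {stack : List (LoopFrame G)} {memo : Memo G} {n : ℕ}
      (h : memo H = some n) :
      Step (.call H stack memo) (.ret n stack memo)
  /-- Otherwise: `(T, r, ι) ←` a rooted clique tree of `H`; `sum ← 0`; `Q ←` queue with the single
  element `r`. -/
  | start {H : G.Subgraph} {stack : List (LoopFrame G)} {memo : Memo G}
      (h : memo H = none) (T : RootedCliqueTree H) :
      Step (.call H stack memo) (.whileLoop ⟨H, T, 0, [T.root]⟩ stack memo)
  /-- `Q` is not empty: `v ← pop(Q)`; `push(Q, children(v))`; `prod ← 1`; enter the `foreach` loop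
  over `𝒞_H(ι(v))`. -/
  | pop {H : G.Subgraph} {T : RootedCliqueTree H} {sum : ℕ} {v : T.Node} {Q : List T.Node}
      {stack : List (LoopFrame G)} {memo : Memo G}
      {children : List T.Node} (hchildren : Enumerates children {w | T.IsChild v w})
      {comps : List G.Subgraph} (hcomps : Enumerates comps (components H (T.ι v))) :
      Step (.whileLoop ⟨H, T, sum, v :: Q⟩ stack memo)
        (.forLoop ⟨⟨H, T, sum, Q ++ children⟩, v, 1, comps⟩ stack memo)
  /-- The next component `C` of the `foreach` loop: call `count C`. -/
  | recurse {f : Frame G} {v : f.T.Node} {prod : ℕ} {C : G.Subgraph} {todo : List G.Subgraph}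
      {stack : List (LoopFrame G)} {memo : Memo G} :
      Step (.forLoop ⟨f, v, prod, C :: todo⟩ stack memo)
        (.call C (⟨f, v, prod, todo⟩ :: stack) memo)
  /-- The recursive call has returned `n`: `prod ← prod * n`. -/
  | resume {f : Frame G} {v : f.T.Node} {prod : ℕ} {todo : List G.Subgraph} {n : ℕ}
      {stack : List (LoopFrame G)} {memo : Memo G} :
      Step (.ret n (⟨f, v, prod, todo⟩ :: stack) memo)
        (.forLoop ⟨f, v, prod * n, todo⟩ stack memo)
  /-- The `foreach` loop is finished: `sum ← sum + φ(ι(v), FP(v, T)) * prod`. -/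
  | add {H : G.Subgraph} {T : RootedCliqueTree H} {sum : ℕ} {Q : List T.Node} {v : T.Node}
      {prod : ℕ} {stack : List (LoopFrame G)} {memo : Memo G} :
      Step (.forLoop ⟨⟨H, T, sum, Q⟩, v, prod, []⟩ stack memo)
        (.whileLoop ⟨H, T, sum + phi (T.ι v) (T.FP v) * prod, Q⟩ stack memo)
  /-- `Q` is empty: `memo[H] = sum`; return `sum`. -/
  | finish {H : G.Subgraph} {T : RootedCliqueTree H} {sum : ℕ}
      {stack : List (LoopFrame G)} {memo : Memo G} :
      Step (.whileLoop ⟨H, T, sum, []⟩ stack memo)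
        (.ret sum stack (Function.update memo H (some sum)))

/-- The initial state on input `G`: `count G` with an empty table. -/
def State.init {V : Type u} (G : SimpleGraph V) : State G :=
  .call ⊤ [] fun _ => none

/-- The algorithm on input `G` always returns `n`, whatever choices it makes: there is no infinite
run, and a run that cannot be continued has returned `n` from the outermost call of `count`. -/
def Returns {V : Type u} (G : SimpleGraph V) (n : ℕ) : Prop :=
  (¬ ∃ run : ℕ → State G, run 0 = State.init G ∧ ∀ i, Step (run i) (run (i + 1))) ∧
  ∀ s : State G, Relation.ReflTransGen Step (State.init G) s → (∀ s', ¬ Step s s') →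
    ∃ memo, s = .ret n [] memo

end CliquePicking

/-!
Call a clique `K` *initial* in an AMO if no edge enters `K` from outside. An ordering of the AMO can
begin with the permutation `π` of `K` if and only if `K` is initial and oriented by `π`. Given `π`,
morality and acyclicity force the direction of some edges outside `K`. The edges that are not forced
are the undirected edges of `H^π(K)` outside `K`, and the AMOs beginning with `π` arise by choosing
an AMO on each undirected component independently, so `π` contributes the product of the counts of
the components.

Several maximal cliques may be initial in the same AMO. To count it once, take a node `v` of the
clique tree such that `ι(v)` is initial and no member of `FP(v)` is. Two such nodes `v ≠ w` cannot
coexist: `ι(v) ∩ ι(w)` is initial, and it is a separator on the path between `v` and `w`, hence lies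
in `FP(v)` or in `FP(w)`. Such a node exists: if `P` is a smallest initial member of `FP(v)`, then
some node `w` with `P ⊂ ι(w)` that no edge with separator `P` cuts off from the root has an initial
clique, and every initial member of `FP(w)` is larger than `P`. Since the initial subsets of `ι(v)`
are the initial segments of its order, `φ(ι(v), FP(v))` counts the orders that are allowed at `v`.
-/

namespace CliquePicking

section Within

variable {V : Type*} {G : SimpleGraph V} {X Y : Set V}

/-- The edges of `G` between vertices of `X`. The graph lives on the whole vertex type, so that the
vertices outside `X` are isolated. -/
def within (G : SimpleGraph V) (X : Set V) : SimpleGraph V where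
  Adj a b := G.Adj a b ∧ a ∈ X ∧ b ∈ X
  symm := ⟨fun _ _ h => ⟨h.1.symm, h.2.2, h.2.1⟩⟩
  loopless := ⟨fun _ h => G.loopless.irrefl _ h.1⟩

theorem within_mono (h : X ⊆ Y) : within G X ≤ within G Y :=
  fun _ _ hab => ⟨hab.1, h hab.2.1, h hab.2.2⟩

theorem mem_of_reachable_within {a b : V} (ha : a ∈ X) (h : (within G X).Reachable a b) :
    b ∈ X := by
  rw [SimpleGraph.reachable_iff_reflTransGen] at h
  induction h with
  | refl => exact ha
  | tail _ hbc _ => exact hbc.2.2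

end Within

/-! ### Chordal graphs -/

section Chordal

variable {V : Type*} {G : SimpleGraph V}

theorem cycleGraph_adj_iff_val {n : ℕ} {i j : Fin (n + 2)} :
    (SimpleGraph.cycleGraph (n + 2)).Adj i j ↔
      i.val = j.val + 1 ∨ j.val = i.val + 1 ∨
        i.val = 0 ∧ j.val = n + 1 ∨ j.val = 0 ∧ i.val = n + 1 := by
  have val_sub : ∀ a b : Fin (n + 2),
      (a - b).val = 1 ↔ a.val = b.val + 1 ∨ a.val = 0 ∧ b.val = n + 1 := by
    intro a b
    rcases le_or_gt b a with h | h
    · rw [Fin.sub_val_of_le h]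
      have := Fin.le_def.1 h
      omega
    · rw [Fin.val_sub, Nat.mod_eq_of_lt] <;>
      · have := Fin.lt_def.1 h
        omega
  rw [SimpleGraph.cycleGraph_adj', val_sub, val_sub]
  omega

/-- The cycle consists of the path and the additional vertex `v`. -/
theorem cycleGraph_isIndContained_of_inducedPath {d : ℕ} {v : V} {p : ℕ → V}
    (hinj : Set.InjOn p (Set.Iic d)) (hne : ∀ i ≤ d, p i ≠ v)
    (hp : ∀ i ≤ d, ∀ j ≤ d, (G.Adj (p i) (p j) ↔ i = j + 1 ∨ j = i + 1))
    (hv : ∀ i ≤ d, (G.Adj v (p i) ↔ i = 0 ∨ i = d)) :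
    (SimpleGraph.cycleGraph (d + 2)).IsIndContained G := by
  refine ⟨⟨⟨fun i => if i.1 = 0 then v else p (i.1 - 1), ?_⟩, ?_⟩⟩
  · rintro ⟨i, hi⟩ ⟨j, hj⟩ h
    simp only at h
    split_ifs at h with h1 h2 h2
    · exact Fin.ext (by simp only; omega)
    · exact absurd h.symm (hne _ (by omega))
    · exact absurd h (hne _ (by omega))
    · have := hinj (Set.mem_Iic.2 (by omega)) (Set.mem_Iic.2 (by omega)) h
      exact Fin.ext (by simp only; omega)
  · rintro ⟨i, hi⟩ ⟨j, hj⟩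
    simp only [cycleGraph_adj_iff_val]
    change G.Adj (if i = 0 then v else p (i - 1)) (if j = 0 then v else p (j - 1)) ↔ _
    split_ifs with h1 h2 h2
    · simp only [SimpleGraph.irrefl, false_iff]
      omega
    · rw [hv _ (by omega)]
      omega
    · rw [G.adj_comm, hv _ (by omega)]
      omega
    · rw [hp _ (by omega) _ (by omega)]
      omega

theorem adj_getVert_iff_of_length_eq_dist {x y : V} {p : G.Walk x y} (hp : p.length = G.dist x y)
    {i j : ℕ} (hi : i ≤ p.length) (hj : j ≤ p.length) :
    G.Adj (p.getVert i) (p.getVert j) ↔ i = j + 1 ∨ j = i + 1 := by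
  have no_shortcut : ∀ {i j : ℕ}, j ≤ p.length → G.Adj (p.getVert i) (p.getVert j) →
      j ≤ i + 1 := by
    intro i j hj h
    by_contra hlt
    have := SimpleGraph.dist_le ((p.take i).append (SimpleGraph.Walk.cons h (p.drop j)))
    rw [SimpleGraph.Walk.length_append, SimpleGraph.Walk.length_cons, SimpleGraph.Walk.take_length,
      SimpleGraph.Walk.drop_length] at this
    omega
  constructor
  · intro h
    have hji := no_shortcut hj h
    have hij := no_shortcut hi h.symm
    have hne : i ≠ j := by
      rintro rfl
      exact h.ne rfl
    omega
  · rintro (rfl | rfl)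
    · exact (p.adj_getVert_succ (by omega)).symm
    · exact p.adj_getVert_succ (by omega)

theorem IsChordal.adj_of_reachable_within (hG : IsChordal G) {v x y : V} {D : Set V}
    (hD : ∀ d ∈ D, d ≠ v ∧ ¬ G.Adj v d) (hx : G.Adj v x) (hy : G.Adj v y) (hxy : x ≠ y)
    (hr : (within G (insert x (insert y D))).Reachable x y) : G.Adj x y := by
  by_contra hnadj
  obtain ⟨p, hp⟩ := hr.exists_walk_length_eq_dist
  have hinj : Set.InjOn p.getVert (Set.Iic p.length) :=
    (SimpleGraph.Walk.IsPath.getVert_injOn_iff p).2 (p.isPath_of_length_eq_dist hp)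
  have hlen : 2 ≤ p.length := by
    rw [hp]
    exact hr.one_lt_dist_of_ne_of_not_adj hxy fun h => hnadj h.1
  have hmem : ∀ i, p.getVert i ∈ insert x (insert y D) := fun i =>
    mem_of_reachable_within (Set.mem_insert x _) ⟨p.take i⟩
  have hadj : ∀ i ≤ p.length, ∀ j ≤ p.length,
      (G.Adj (p.getVert i) (p.getVert j) ↔ i = j + 1 ∨ j = i + 1) := fun i hi j hj =>
    Iff.trans ⟨fun h => ⟨h, hmem i, hmem j⟩, fun h => h.1⟩
      (adj_getVert_iff_of_length_eq_dist hp hi hj)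
  have hends : ∀ i ≤ p.length, p.getVert i ∈ D ∨ i = 0 ∨ i = p.length := by
    intro i hi
    rcases hmem i with h | h | h
    · exact .inr (.inl (hinj hi (Nat.zero_le _) (h.trans p.getVert_zero.symm)))
    · exact .inr (.inr (hinj hi Set.self_mem_Iic (h.trans p.getVert_length.symm)))
    · exact .inl h
  have hv : ∀ i, i = 0 ∨ i = p.length → G.Adj v (p.getVert i) := by
    rintro i (rfl | rfl)
    · rwa [p.getVert_zero]
    · rwa [p.getVert_length]
  refine hG (p.length + 2) (by omega) (cycleGraph_isIndContained_of_inducedPath hinj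
    (fun i hi => ?_) hadj fun i hi => ⟨fun h => ?_, hv i⟩)
  · exact (hends i hi).elim (fun h => (hD _ h).1) fun h => (hv i h).ne'
  · exact (hends i hi).resolve_left fun hd => (hD _ hd).2 h

theorem IsChordal.isClique_of_common_component (hG : IsChordal G) {u v : V} {Z S : Set V}
    (hZ : ∀ d ∈ Z, d ≠ v ∧ ¬ G.Adj v d) (hSv : ∀ s ∈ S, G.Adj v s)
    (hS : ∀ s ∈ S, ∃ d ∈ Z, (within G Z).Reachable u d ∧ G.Adj s d) : G.IsClique S := by
  intro x hx y hy hxy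
  obtain ⟨a, haZ, ha, hxa⟩ := hS x hx
  obtain ⟨b, hbZ, hb, hyb⟩ := hS y hy
  have hab : (within G (insert x (insert y Z))).Reachable a b :=
    (ha.symm.trans hb).mono
      (within_mono ((Set.subset_insert _ _).trans (Set.subset_insert _ _)))
  have hxa' : (within G (insert x (insert y Z))).Adj x a := ⟨hxa, by simp, by simp [haZ]⟩
  have hby' : (within G (insert x (insert y Z))).Adj b y := ⟨hyb.symm, by simp [hbZ], by simp⟩
  exact hG.adj_of_reachable_within hZ (hSv x hx) (hSv y hy) hxy
    (hxa'.reachable.trans (hab.trans hby'.reachable))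

theorem exists_nonadj_of_not_clique {X K : Set V} (hX : ¬ G.IsClique X) (hKX : K ⊆ X)
    (hK : G.IsClique K) :
    ∃ v ∈ X, ∃ u ∈ X, u ≠ v ∧ ¬ G.Adj v u ∧ ∀ w ∈ X, w ≠ v → ¬ G.Adj v w → w ∉ K := by
  by_cases h : ∃ k ∈ K, ∃ u ∈ X, u ≠ k ∧ ¬ G.Adj k u
  · obtain ⟨k, hk, u, hu, huk, hn⟩ := h
    exact ⟨k, hKX hk, u, hu, huk, hn, fun w _ hwk hn hw => hn (hK hk hw hwk.symm)⟩
  · push Not at h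
    simp only [SimpleGraph.IsClique, Set.Pairwise] at hX
    push Not at hX
    obtain ⟨v, hv, u, hu, hvu, hn⟩ := hX
    exact ⟨v, hv, u, hu, hvu.symm, hn, fun w _ hwv hn hw => hn (h w hw v hv hwv.symm).symm⟩

/-- `w` is a simplicial vertex of the subgraph of `G` induced by `X`: its neighbours in `X` form a
clique. -/
structure IsSimplicial (G : SimpleGraph V) (X : Set V) (w : V) : Prop where
  mem : w ∈ X
  isClique : G.IsClique (X ∩ G.neighborSet w)

/-- Dirac's theorem. The induction applies it to a component `D` of the non-neighbours of a vertex
`v` together with its boundary `S`: as `S` is a clique, `D` contains a simplicial vertex. -/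
theorem IsChordal.exists_isSimplicial [Finite V] (hG : IsChordal G) (X K : Set V) (hKX : K ⊆ X)
    (hK : G.IsClique K) (hne : K ≠ X) :
    ∃ w, IsSimplicial G X w ∧ w ∉ K := by
  induction hn : X.ncard using Nat.strong_induction_on generalizing X K with
  | _ n ih =>
  by_cases hX : G.IsClique X
  · obtain ⟨w, hwX, hwK⟩ := Set.exists_of_ssubset (hKX.ssubset_of_ne hne)
    exact ⟨w, ⟨hwX, hX.subset Set.inter_subset_left⟩, hwK⟩
  obtain ⟨v, hvX, u, huX, huv, hnuv, hvK⟩ := exists_nonadj_of_not_clique hX hKX hK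
  set Z : Set V := {z | z ∈ X ∧ z ≠ v ∧ ¬ G.Adj v z}
  set D : Set V := {z | (within G Z).Reachable u z}
  set S : Set V := {s | s ∈ X ∧ s ∉ D ∧ ∃ d ∈ D, G.Adj s d}
  have huD : u ∈ D := SimpleGraph.Reachable.refl u
  have hDZ : D ⊆ Z := fun z hz => mem_of_reachable_within ⟨huX, huv, hnuv⟩ hz
  have hSv : ∀ s ∈ S, G.Adj v s := by
    rintro s ⟨hsX, hsD, d, hd, hsd⟩
    by_contra hvs
    have hsv : s ≠ v := fun h => (hDZ hd).2.2 (h ▸ hsd)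
    exact hsD (hd.trans (SimpleGraph.Adj.reachable ⟨hsd.symm, hDZ hd, hsX, hsv, hvs⟩))
  have hS : G.IsClique S := hG.isClique_of_common_component (fun d hd => hd.2) hSv
    fun s ⟨_, _, d, hd, hsd⟩ => ⟨d, hDZ hd, hd, hsd⟩
  have hlt : (D ∪ S).ncard < n := by
    have hsub : D ∪ S ⊆ X := Set.union_subset (fun z hz => (hDZ hz).1) fun z hz => hz.1
    have hv : v ∉ D ∪ S := fun h =>
      h.elim (fun hD => (hDZ hD).2.1 rfl) fun hS => (hSv v hS).ne rfl
    exact hn ▸ Set.ncard_lt_ncard ((Set.ssubset_iff_of_subset hsub).2 ⟨v, hvX, hv⟩)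
  obtain ⟨w, hwc, hwS⟩ := ih _ hlt (D ∪ S) S Set.subset_union_right hS
    (fun h => (h ▸ Set.mem_union_left S huD : u ∈ S).2.1 huD) rfl
  have hwD : w ∈ D := hwc.mem.resolve_right hwS
  have hwZ := hDZ hwD
  refine ⟨w, ⟨hwZ.1, hwc.isClique.subset ?_⟩, hvK w hwZ.1 hwZ.2.1 hwZ.2.2⟩
  rintro a ⟨haX, hwa⟩
  refine ⟨?_, hwa⟩
  by_cases haD : a ∈ D
  · exact .inl haD
  · exact .inr ⟨haX, haD, w, hwD, hwa.symm⟩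

/-- Removing the vertices of `Γ` in decreasing order of `f` is a perfect elimination: adjacent
vertices have different ranks, and the neighbours of smaller rank of a vertex form a clique. -/
structure IsEliminationRank (Γ : SimpleGraph V) (f : V → ℕ) : Prop where
  ne_of_adj : ∀ {a b}, Γ.Adj a b → f a ≠ f b
  adj_of_lt : ∀ {a b c}, a ≠ c → Γ.Adj a b → Γ.Adj c b → f a < f b → f c < f b → Γ.Adj a c

theorem isEliminationRank_of_clique {K : Set V} (hK : G.IsClique K) {f : V → ℕ}
    (hf : Set.InjOn f K) : IsEliminationRank (within G K) f where
  ne_of_adj hab h := hab.1.ne (hf hab.2.1 hab.2.2 h)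
  adj_of_lt hac hab hcb _ _ := ⟨hK hab.2.1 hcb.2.1 hac, hab.2.1, hcb.2.1⟩

open Classical in
theorem IsEliminationRank.update_simplicial {X : Set V} {w : V} {f : V → ℕ} {m : ℕ}
    (hf : IsEliminationRank (within G (X \ {w})) f)
    (hw : IsSimplicial G X w) (hm : ∀ x, f x < m) :
    IsEliminationRank (within G X) (Function.update f w m) where
  ne_of_adj {a b} hab := by
    have hne := hab.1.ne
    by_cases ha : a = w
    · subst ha
      simpa [hne.symm] using (hm b).ne'
    by_cases hb : b = w
    · subst hb
      simpa [hne] using (hm a).ne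
    simpa [ha, hb] using hf.ne_of_adj ⟨hab.1, ⟨hab.2.1, ha⟩, hab.2.2, hb⟩
  adj_of_lt {a b c} hac hab hcb ha hc := by
    have lt_of_ne : ∀ x, Function.update f w m x < Function.update f w m b → x ≠ w := by
      rintro x hx rfl
      by_cases hb : b = x
      · simp [hb] at hx
      · simp only [Function.update_self, Function.update_of_ne hb] at hx
        exact hx.not_gt (hm b)
    have haw := lt_of_ne a ha
    have hcw := lt_of_ne c hc
    by_cases hb : b = w
    · subst hb
      exact ⟨hw.isClique ⟨hab.2.1, hab.1.symm⟩ ⟨hcb.2.1, hcb.1.symm⟩ hac, hab.2.1, hcb.2.1⟩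
    · simp only [Function.update_of_ne haw, Function.update_of_ne hcw,
        Function.update_of_ne hb] at ha hc
      exact within_mono Set.sdiff_subset (hf.adj_of_lt hac ⟨hab.1, ⟨hab.2.1, haw⟩, hab.2.2, hb⟩
        ⟨hcb.1, ⟨hcb.2.1, hcw⟩, hcb.2.2, hb⟩ ha hc)

theorem IsChordal.exists_isEliminationRank [Finite V] (hG : IsChordal G) {X K : Set V}
    (hKX : K ⊆ X) (hK : G.IsClique K) {f₀ : V → ℕ} (hf₀ : Set.InjOn f₀ K) :
    ∃ f, IsEliminationRank (within G X) f ∧ Set.EqOn f f₀ K ∧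
      ∀ k ∈ K, ∀ x ∈ X, x ∉ K → f k < f x := by
  classical
  induction hn : X.ncard using Nat.strong_induction_on generalizing X with
  | _ n ih =>
  by_cases hne : K = X
  · exact ⟨f₀, hne ▸ isEliminationRank_of_clique hK hf₀, Set.eqOn_refl f₀ K,
      fun k _ x hx hxK => absurd (hne ▸ hx) hxK⟩
  obtain ⟨w, hw, hwK⟩ := hG.exists_isSimplicial X K hKX hK hne
  obtain ⟨f, hf, hfK, hlt⟩ := ih _ (hn ▸ Set.ncard_sdiff_singleton_lt_of_mem hw.mem)
    (Set.subset_sdiff_singleton hKX hwK) rfl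
  obtain ⟨m, hm⟩ := (Set.finite_range f).bddAbove
  have hm' : ∀ x, f x < m + 1 := fun x => Nat.lt_succ_of_le (hm ⟨x, rfl⟩)
  have hkw : ∀ k ∈ K, k ≠ w := fun k hk h => hwK (h ▸ hk)
  refine ⟨Function.update f w (m + 1), hf.update_simplicial hw hm', fun k hk => ?_,
    fun k hk x hx hxK => ?_⟩
  · rw [Function.update_of_ne (hkw k hk), hfK hk]
  · rw [Function.update_of_ne (hkw k hk)]
    by_cases hxw : x = w
    · rw [hxw, Function.update_self]
      exact hm' k
    · rw [Function.update_of_ne hxw]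
      exact hlt k hk x ⟨hx, hxw⟩ hxK

end Chordal

/-! ### Clique trees -/

section MaximalCliques

variable {V : Type*} {G : SimpleGraph V} {X S K : Set V} {w : V}

/-- `K` is a maximal clique of the subgraph of `G` induced by `X`. -/
abbrev IsMaxCliqueWithin (G : SimpleGraph V) (X K : Set V) : Prop :=
  Maximal (fun K' : Set V => K' ⊆ X ∧ G.IsClique K') K

theorem exists_isMaxCliqueWithin_ge [Finite V] (hSX : S ⊆ X) (hS : G.IsClique S) :
    ∃ K, IsMaxCliqueWithin G X K ∧ S ⊆ K := by
  obtain ⟨K, hSK, hK⟩ := Finite.exists_le_maximal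
    (p := fun K' : Set V => K' ⊆ X ∧ G.IsClique K') ⟨hSX, hS⟩
  exact ⟨K, hK, hSK⟩

theorem subset_insert_neighborSet (hKX : K ⊆ X) (hK : G.IsClique K) (hw : w ∈ K) :
    K ⊆ insert w (X ∩ G.neighborSet w) := fun a ha => by
  by_cases haw : a = w
  · exact .inl haw
  · exact .inr ⟨hKX ha, hK hw ha (Ne.symm haw)⟩

theorem IsSimplicial.isMaxCliqueWithin_insert (hw : IsSimplicial G X w) :
    IsMaxCliqueWithin G X (insert w (X ∩ G.neighborSet w)) :=
  ⟨⟨Set.insert_subset hw.mem Set.inter_subset_left, hw.isClique.insert fun _ hb _ => hb.2⟩,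
    fun _ hK hle => subset_insert_neighborSet hK.1 hK.2 (hle (Set.mem_insert w _))⟩

theorem inter_neighborSet_subset :
    X ∩ G.neighborSet w ⊆ X \ {w} :=
  fun _ ha => ⟨ha.1, ha.2.ne'⟩

theorem IsSimplicial.isMaxCliqueWithin_iff (hw : IsSimplicial G X w) :
    IsMaxCliqueWithin G X K ↔ K = insert w (X ∩ G.neighborSet w) ∨
      IsMaxCliqueWithin G (X \ {w}) K ∧ K ≠ X ∩ G.neighborSet w := by
  constructor
  · intro hK
    by_cases hwK : w ∈ K
    · exact .inl (hK.eq_of_le hw.isMaxCliqueWithin_insert.prop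
        (subset_insert_neighborSet hK.prop.1 hK.prop.2 hwK))
    · refine .inr ⟨⟨⟨Set.subset_sdiff_singleton hK.prop.1 hwK, hK.prop.2⟩, fun K' hK' =>
        hK.le_of_ge ⟨hK'.1.trans Set.sdiff_subset, hK'.2⟩⟩, ?_⟩
      rintro rfl
      exact hwK (hK.le_of_ge hw.isMaxCliqueWithin_insert.prop (Set.subset_insert _ _)
        (Set.mem_insert _ _))
  · rintro (rfl | ⟨hK, hKS⟩)
    · exact hw.isMaxCliqueWithin_insert
    · refine ⟨⟨hK.prop.1.trans Set.sdiff_subset, hK.prop.2⟩, fun K' hK' hKK' => ?_⟩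
      by_cases hwK' : w ∈ K'
      · refine absurd (hK.eq_of_le ⟨inter_neighborSet_subset, hw.isClique⟩ ?_) hKS
        exact fun a ha => (subset_insert_neighborSet hK'.1 hK'.2 hwK' (hKK' ha)).resolve_left
          (hK.prop.1 ha).2
      · exact hK.le_of_ge ⟨Set.subset_sdiff_singleton hK'.1 hwK', hK'.2⟩ hKK'

end MaximalCliques

section ParentCliqueTree

variable {V : Type u} {G : SimpleGraph V} {X : Set V} {w : V} {N : Type*} {ι : N → Set V} {r : N}
  {p : N → N} {ρ : N → ℕ}

/-- A clique tree of the subgraph of `G` induced by `X`, given by the parent `p x` of every node `x`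
except the root `r`. The rank `ρ` makes the parent relation well-founded, and `t` in the last field
is the node closest to the root among those whose clique contains `v`. -/
structure IsParentCliqueTree (G : SimpleGraph V) (X : Set V) (ι : N → Set V) (r : N) (p : N → N)
    (ρ : N → ℕ) : Prop where
  injective : Function.Injective ι
  mem_range_iff : ∀ K, K ∈ Set.range ι ↔ IsMaxCliqueWithin G X K
  rank_parent_lt : ∀ x, x ≠ r → ρ (p x) < ρ x
  exists_top : ∀ v ∈ X, ∃ t, v ∈ ι t ∧ ∀ x, v ∈ ι x → x ≠ t → x ≠ r ∧ v ∈ ι (p x)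

theorem isParentCliqueTree_empty :
    IsParentCliqueTree G ∅ (fun _ : PUnit => ∅) PUnit.unit id fun _ => 0 where
  injective _ _ _ := rfl
  mem_range_iff K := by
    rw [Set.range_const, Set.mem_singleton_iff]
    refine ⟨?_, fun h => Set.subset_empty_iff.1 h.prop.1⟩
    rintro rfl
    exact ⟨⟨subset_rfl, SimpleGraph.isClique_empty⟩, fun _ hK _ => hK.1⟩
  rank_parent_lt x hx := absurd rfl hx
  exists_top _ hv := absurd hv (Set.notMem_empty _)

theorem IsParentCliqueTree.isMaxCliqueWithin (h : IsParentCliqueTree G X ι r p ρ) (x : N) :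
    IsMaxCliqueWithin G X (ι x) :=
  (h.mem_range_iff _).1 ⟨x, rfl⟩

theorem IsParentCliqueTree.insert_simplicial_of_eq [DecidableEq N]
    (h : IsParentCliqueTree G (X \ {w}) ι r p ρ) (hw : IsSimplicial G X w) {x₀ : N}
    (hx₀ : ι x₀ = X ∩ G.neighborSet w) :
    IsParentCliqueTree G X (Function.update ι x₀ (insert w (ι x₀))) r p ρ := by
  have hwι : ∀ x, w ∉ ι x := fun x hx => ((h.isMaxCliqueWithin x).prop.1 hx).2 rfl
  have mem_iff : ∀ {v x}, v ≠ w →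
      (v ∈ Function.update ι x₀ (insert w (ι x₀)) x ↔ v ∈ ι x) := by
    intro v x hv
    by_cases hx : x = x₀
    · subst hx
      simp [hv]
    · simp [hx]
  have w_mem_iff : ∀ {x}, w ∈ Function.update ι x₀ (insert w (ι x₀)) x ↔ x = x₀ := by
    intro x
    by_cases hx : x = x₀
    · subst hx
      simp
    · simp [hx, hwι]
  refine ⟨fun x y hxy => h.injective ?_, fun K => ?_, h.rank_parent_lt, fun v hv => ?_⟩
  · ext v
    by_cases hv : v = w
    · simp [hv, hwι]
    · rw [← mem_iff hv, hxy, mem_iff hv]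
  · rw [hw.isMaxCliqueWithin_iff, ← h.mem_range_iff, ← hx₀]
    constructor
    · rintro ⟨x, rfl⟩
      by_cases hx : x = x₀
      · subst hx
        exact .inl (Function.update_self _ _ _)
      · rw [Function.update_of_ne hx]
        exact .inr ⟨⟨x, rfl⟩, h.injective.ne hx⟩
    · rintro (rfl | ⟨⟨x, rfl⟩, hx⟩)
      · exact ⟨x₀, Function.update_self _ _ _⟩
      · exact ⟨x, Function.update_of_ne (fun h' => hx (congrArg ι h')) _ _⟩
  · by_cases hvw : v = w
    · subst hvw
      exact ⟨x₀, w_mem_iff.2 rfl, fun x hx hne => absurd (w_mem_iff.1 hx) hne⟩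
    · simp only [mem_iff hvw]
      exact h.exists_top v ⟨hv, hvw⟩

theorem IsParentCliqueTree.insert_simplicial_of_subset
    (h : IsParentCliqueTree G (X \ {w}) ι r p ρ) (hw : IsSimplicial G X w)
    (hne : ∀ x, ι x ≠ X ∩ G.neighborSet w) {x₀ : N} (hx₀ : X ∩ G.neighborSet w ⊆ ι x₀) :
    IsParentCliqueTree G X (fun o : Option N => o.elim (insert w (X ∩ G.neighborSet w)) ι)
      (some r) (fun o => some (o.elim x₀ p)) fun o => o.elim (ρ x₀ + 1) ρ := by
  have hwι : ∀ x, w ∉ ι x := fun x hx => ((h.isMaxCliqueWithin x).prop.1 hx).2 rfl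
  refine ⟨?_, fun K => ?_, ?_, fun v hv => ?_⟩
  · rintro (_ | x) (_ | y) hxy
    · rfl
    · exact absurd ((Set.ext_iff.1 hxy w).1 (Set.mem_insert w _)) (hwι y)
    · exact absurd ((Set.ext_iff.1 hxy w).2 (Set.mem_insert w _)) (hwι x)
    · exact congrArg some (h.injective hxy)
  · rw [hw.isMaxCliqueWithin_iff, ← h.mem_range_iff]
    constructor
    · rintro ⟨_ | x, rfl⟩
      · exact .inl rfl
      · exact .inr ⟨⟨x, rfl⟩, hne x⟩
    · rintro (rfl | ⟨⟨x, rfl⟩, -⟩)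
      · exact ⟨none, rfl⟩
      · exact ⟨some x, rfl⟩
  · rintro (_ | x) hx
    · exact Nat.lt_succ_self _
    · exact h.rank_parent_lt x fun hxr => hx (congrArg some hxr)
  · by_cases hvw : v = w
    · subst hvw
      refine ⟨none, Set.mem_insert v _, ?_⟩
      rintro (_ | x) hx hxt
      · exact absurd rfl hxt
      · exact absurd hx (hwι x)
    · obtain ⟨t, hvt, ht⟩ := h.exists_top v ⟨hv, hvw⟩
      refine ⟨some t, hvt, ?_⟩
      rintro (_ | x) hx hxt
      · exact ⟨nofun, hx₀ (hx.resolve_left hvw)⟩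
      · have := ht x hx fun h => hxt (congrArg some h)
        exact ⟨fun h => this.1 (Option.some_injective _ h), this.2⟩

theorem IsChordal.exists_isParentCliqueTree [Finite V] (hG : IsChordal G) (X : Set V) :
    ∃ (N : Type u) (ι : N → Set V) (r : N) (p : N → N) (ρ : N → ℕ),
      IsParentCliqueTree G X ι r p ρ := by
  classical
  induction hn : X.ncard using Nat.strong_induction_on generalizing X with
  | _ n ih =>
  rcases X.eq_empty_or_nonempty with rfl | hX
  · exact ⟨_, _, _, _, _, isParentCliqueTree_empty⟩
  obtain ⟨w, hw, -⟩ := hG.exists_isSimplicial X ∅ (Set.empty_subset X) (Set.pairwise_empty _)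
    hX.ne_empty.symm
  obtain ⟨N, ι, r, p, ρ, h⟩ :=
    ih _ (hn ▸ Set.ncard_sdiff_singleton_lt_of_mem hw.mem) (X \ {w}) rfl
  by_cases hS : ∃ x₀, ι x₀ = X ∩ G.neighborSet w
  · obtain ⟨x₀, hx₀⟩ := hS
    exact ⟨_, _, _, _, _, h.insert_simplicial_of_eq hw hx₀⟩
  · obtain ⟨K, hK, hSK⟩ := exists_isMaxCliqueWithin_ge
      (inter_neighborSet_subset (G := G)) hw.isClique
    obtain ⟨x₀, rfl⟩ := (h.mem_range_iff K).2 hK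
    exact ⟨_, _, _, _, _, h.insert_simplicial_of_subset hw (not_exists.1 hS) hSK⟩

end ParentCliqueTree

section ParentGraph

variable {N : Type*} {r : N} {p : N → N} {ρ : N → ℕ}

/-- The graph which joins every node except `r` with its parent under `p`. -/
def parentGraph (r : N) (p : N → N) : SimpleGraph N :=
  SimpleGraph.fromRel fun x y => x ≠ r ∧ y = p x

theorem parentGraph_adj (hρ : ∀ x, x ≠ r → ρ (p x) < ρ x) {x : N} (hx : x ≠ r) :
    (parentGraph r p).Adj x (p x) :=
  ⟨fun h => (hρ x hx).ne (congrArg ρ h.symm), .inl ⟨hx, rfl⟩⟩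

theorem parentGraph_induce_connected (hρ : ∀ x, x ≠ r → ρ (p x) < ρ x) {S : Set N} {t : N}
    (ht : t ∈ S) (hS : ∀ x ∈ S, x ≠ t → x ≠ r ∧ p x ∈ S) :
    ((parentGraph r p).induce S).Connected := by
  have reachable_top : ∀ n x (hx : x ∈ S), ρ x = n →
      ((parentGraph r p).induce S).Reachable ⟨x, hx⟩ ⟨t, ht⟩ := by
    intro n
    induction n using Nat.strong_induction_on with
    | _ n ih =>
    rintro x hx rfl
    by_cases hxt : x = t
    · subst hxt
      rfl
    · obtain ⟨hxr, hpx⟩ := hS x hx hxt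
      have hadj : ((parentGraph r p).induce S).Adj ⟨x, hx⟩ ⟨p x, hpx⟩ := parentGraph_adj hρ hxr
      exact hadj.reachable.trans (ih _ (hρ x hxr) (p x) hpx rfl)
  have : Nonempty S := ⟨⟨t, ht⟩⟩
  exact ⟨fun a b => (reachable_top _ a.1 a.2 rfl).trans (reachable_top _ b.1 b.2 rfl).symm⟩

theorem bijective_parentGraph_edge (hρ : ∀ x, x ≠ r → ρ (p x) < ρ x) :
    Function.Bijective fun x : {x : N // x ≠ r} =>
      (⟨s(x.1, p x.1), parentGraph_adj hρ x.2⟩ : (parentGraph r p).edgeSet) := by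
  constructor
  · rintro ⟨x, hx⟩ ⟨y, hy⟩ h
    refine Subtype.ext ?_
    rcases Sym2.eq_iff.1 (congrArg Subtype.val h) with h | ⟨hxy, hyx⟩
    · exact h.1
    · have h₁ : ρ y < ρ x := by simpa only [hyx] using hρ x hx
      have h₂ : ρ x < ρ y := by simpa only [← hxy] using hρ y hy
      exact absurd h₁ h₂.not_gt
  · rintro ⟨e, he⟩
    induction e using Sym2.ind with
    | _ x y =>
    have hadj : (parentGraph r p).Adj x y := he
    rcases hadj.2 with ⟨hx, rfl⟩ | ⟨hy, rfl⟩
    · exact ⟨⟨x, hx⟩, rfl⟩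
    · exact ⟨⟨y, hy⟩, Subtype.ext Sym2.eq_swap⟩

theorem parentGraph_isTree [Finite N] (hρ : ∀ x, x ≠ r → ρ (p x) < ρ x) :
    (parentGraph r p).IsTree := by
  classical
  rw [SimpleGraph.isTree_iff_connected_and_card]
  constructor
  · exact (SimpleGraph.induceUnivIso _).connected_iff.1
      (parentGraph_induce_connected hρ (Set.mem_univ r) fun x _ hx => ⟨hx, trivial⟩)
  · rw [← Nat.card_congr (Equiv.ofBijective _ (bijective_parentGraph_edge hρ)),
      ← Nat.card_congr (Equiv.optionSubtypeNe r), Finite.card_option]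

end ParentGraph

section RootedCliqueTree

variable {V : Type*} {G : SimpleGraph V} {H : G.Subgraph}

theorem maxCliques_eq (hH : H.IsInduced) : maxCliques H = {K | IsMaxCliqueWithin G H.verts K} := by
  have : (fun K : Set V => K ⊆ H.verts ∧ K.Pairwise H.Adj) =
      fun K : Set V => K ⊆ H.verts ∧ G.IsClique K := by
    funext K
    refine propext (and_congr_right fun hK => ⟨fun h => h.mono' fun _ _ h => h.adj_sub, ?_⟩)
    exact fun h a ha b hb hab => hH (hK ha) (hK hb) (h ha hb hab)
  rw [maxCliques, this]

theorem spanningCoe_eq_within (hH : H.IsInduced) : H.spanningCoe = within G H.verts := by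
  ext a b
  exact ⟨fun h : H.Adj a b => ⟨h.adj_sub, H.edge_vert h, H.edge_vert h.symm⟩,
    fun h => hH h.2.1 h.2.2 h.1⟩

theorem IsChordal.nonempty_rootedCliqueTree [Finite V] (hG : IsChordal G) (hH : H.IsInduced) :
    Nonempty (RootedCliqueTree H) := by
  obtain ⟨N, ι, r, p, ρ, h⟩ := hG.exists_isParentCliqueTree H.verts
  have := Finite.of_injective ι h.injective
  have hrange : Set.range ι = maxCliques H :=
    (Set.ext h.mem_range_iff).trans (maxCliques_eq hH).symm
  refine ⟨⟨N, parentGraph r p, parentGraph_isTree h.rank_parent_lt, r, ι, ?_, fun v hv => ?_⟩⟩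
  · rw [← hrange, ← Set.image_univ]
    exact h.injective.injOn.bijOn_image
  · obtain ⟨t, hvt, ht⟩ := h.exists_top v hv
    exact parentGraph_induce_connected h.rank_parent_lt hvt ht

end RootedCliqueTree

/-! ### Acyclic moral orientations with a prescribed initial clique -/

section AMO

variable {V : Type*} {Γ F : SimpleGraph V} {α : Digraph V}

theorem IsAcyclic.wellFounded [Finite V] (h : IsAcyclic α) : WellFounded α.Adj := by
  have : Std.Irrefl (Relation.TransGen α.Adj) := ⟨h⟩
  have hwf : WellFounded (Relation.TransGen α.Adj) := Finite.wellFounded_of_trans_of_irrefl _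
  exact hwf.mono fun _ _ => Relation.TransGen.single

theorem IsAcyclic.exists_source [Finite V] (h : IsAcyclic α) {Y : Set V} (hY : Y.Nonempty) :
    ∃ y ∈ Y, ∀ x ∈ Y, ¬ α.Adj x y :=
  h.wellFounded.has_min Y hY

theorem isAcyclic_of_exists_source
    (h : ∀ Y : Set V, Y.Nonempty → ∃ y ∈ Y, ∀ x ∈ Y, ¬ α.Adj x y) : IsAcyclic α :=
  fun v => (WellFounded.wellFounded_iff_has_min.2 h).transGen.irrefl.irrefl v

theorem IsAMO.adj (h : IsAMO Γ α) {a b : V} (hab : α.Adj a b) : Γ.Adj a b :=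
  (h.orientation.1 a b).2 (.inl hab)

theorem IsAMO.adj_or (h : IsAMO Γ α) {a b : V} (hab : Γ.Adj a b) : α.Adj a b ∨ α.Adj b a :=
  (h.orientation.1 a b).1 hab

theorem IsAMO.not_adj_symm (h : IsAMO Γ α) {a b : V} (hab : α.Adj a b) : ¬ α.Adj b a :=
  h.orientation.2 a b hab

theorem IsAMO.adj_of_adj_of_adj (h : IsAMO Γ α) {a b c : V} (hac : a ≠ c) (hab : α.Adj a b)
    (hcb : α.Adj c b) : Γ.Adj a c :=
  (h.orientation.1 a c).2 (h.moral a b c hac hab hcb)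

theorem isAMO_of_adj (hle : ∀ a b, α.Adj a b → Γ.Adj a b)
    (hor : ∀ a b, Γ.Adj a b → α.Adj a b ∨ α.Adj b a) (hacyc : IsAcyclic α)
    (hmoral : ∀ a b c, a ≠ c → α.Adj a b → α.Adj c b → Γ.Adj a c) : IsAMO Γ α where
  orientation := ⟨fun a b => ⟨hor a b, fun h => h.elim (hle a b) fun h => (hle b a h).symm⟩,
    fun a _ hab hba => hacyc a (.tail (.single hab) hba)⟩
  acyclic := hacyc
  moral a b c hac hab hcb := hor a c (hmoral a b c hac hab hcb)

/-- The part of the orientation `α` on the edges of `F`. -/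
def restrict (α : Digraph V) (F : SimpleGraph V) : Digraph V where
  Adj a b := α.Adj a b ∧ F.Adj a b

theorem IsAMO.restrict (h : IsAMO Γ α) (hF : F ≤ Γ)
    (hind : ∀ a b c, F.Adj a b → F.Adj c b → Γ.Adj a c → F.Adj a c) :
    IsAMO F (restrict α F) :=
  isAMO_of_adj (fun _ _ hab => hab.2)
    (fun _ _ hab => (h.adj_or (hF hab)).imp (⟨·, hab⟩) (⟨·, hab.symm⟩))
    (fun v hv => h.acyclic v (Relation.TransGen.mono (fun _ _ hab => hab.1) v v hv))
    fun a b c hac hab hcb => hind a b c hab.2 hcb.2 (h.adj_of_adj_of_adj hac hab.1 hcb.1)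

theorem IsAMO.exists_source_reaching [Finite V] (h : IsAMO Γ α) (y : V) :
    ∃ r, (∀ x, ¬ α.Adj x r) ∧ Relation.ReflTransGen α.Adj r y := by
  induction y using h.acyclic.wellFounded.induction with
  | _ y ih =>
  by_cases hy : ∃ x, α.Adj x y
  · obtain ⟨x, hx⟩ := hy
    obtain ⟨r, hr, hrx⟩ := ih x hx
    exact ⟨r, hr, hrx.tail hx⟩
  · push Not at hy
    exact ⟨y, hy, .refl⟩

theorem IsAMO.source_unique [Finite V] (h : IsAMO Γ α) {s t : V} (hs : ∀ x, ¬ α.Adj x s)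
    (ht : ∀ x, ¬ α.Adj x t) (y : V) (hsy : Relation.ReflTransGen α.Adj s y)
    (hty : Relation.ReflTransGen α.Adj t y) : s = t := by
  induction y using h.acyclic.wellFounded.induction with
  | _ y ih =>
  rcases hsy.cases_tail with rfl | ⟨p, hsp, hpy⟩
  · rcases hty.cases_tail with rfl | ⟨q, -, hqy⟩
    · rfl
    · exact absurd hqy (hs q)
  rcases hty.cases_tail with rfl | ⟨q, htq, hqy⟩
  · exact absurd hpy (ht p)
  by_cases hpq : p = q
  · exact ih p hpy hsp (hpq ▸ htq)
  rcases h.moral p y q hpq hpy hqy with hpq | hqp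
  · exact ih q hqy (hsp.tail hpq) htq
  · exact ih p hpy hsp (htq.tail hqp)

theorem IsAMO.source_unique_of_reachable [Finite V] (h : IsAMO Γ α) {s t : V}
    (hs : ∀ x, ¬ α.Adj x s) (ht : ∀ x, ¬ α.Adj x t) (hst : Γ.Reachable s t) : s = t := by
  suffices ∀ z, Γ.Reachable s z → Relation.ReflTransGen α.Adj s z from
    h.source_unique hs ht t (this t hst) .refl
  intro z hz
  rw [SimpleGraph.reachable_iff_reflTransGen] at hz
  induction hz with
  | refl => exact .refl
  | @tail b c _ hbc ih =>
    rcases h.adj_or hbc with hbc | hcb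
    · exact ih.tail hbc
    · obtain ⟨r, hr, hrc⟩ := h.exists_source_reaching c
      exact h.source_unique hs hr b ih (hrc.tail hcb) ▸ hrc

/-- The orientation of `Γ` from smaller to larger rank. -/
def orientByRank (Γ : SimpleGraph V) (f : V → ℕ) : Digraph V where
  Adj a b := Γ.Adj a b ∧ f a < f b

theorem IsEliminationRank.isAMO_orientByRank {f : V → ℕ} (hf : IsEliminationRank Γ f) :
    IsAMO Γ (orientByRank Γ f) := by
  refine isAMO_of_adj (fun _ _ hab => hab.1) (fun a b hab => ?_)
    (isAcyclic_of_exists_source fun Y hY => ?_)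
    fun a b c hac hab hcb => hf.adj_of_lt hac hab.1 hcb.1 hab.2 hcb.2
  · exact (hf.ne_of_adj hab).lt_or_gt.imp (⟨hab, ·⟩) (⟨hab.symm, ·⟩)
  · obtain ⟨y, hy, hmin⟩ := (InvImage.wf f wellFounded_lt).has_min Y hY
    exact ⟨y, hy, fun x hx hxy => hmin x hx hxy.2⟩

end AMO

section Initial

variable {V : Type*} {Γ : SimpleGraph V} {α : Digraph V} {K S : Set V} {l : List V}

theorem IsPermOf.mem_iff (h : IsPermOf l S) {x : V} : x ∈ l ↔ x ∈ S :=
  Set.ext_iff.1 h.2 x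

theorem exists_enumerates {A : Type*} [Finite A] (s : Set A) : ∃ l, Enumerates l s :=
  ⟨s.toFinite.toFinset.toList, Finset.nodup_toList _, fun a => by
    rw [Finset.mem_toList, Set.Finite.mem_toFinset]⟩

theorem exists_isPermOf [Finite V] (S : Set V) : ∃ l, IsPermOf l S :=
  (exists_enumerates S).imp fun _ hl => ⟨hl.1, Set.ext hl.2⟩

/-- `K` is closed under taking parents. -/
def IsInitial (α : Digraph V) (K : Set V) : Prop :=
  ∀ a b, α.Adj a b → b ∈ K → a ∈ K

theorem IsInitial.subset_or_subset (hα : IsAMO Γ α) (hS : IsInitial α S) {S' : Set V}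
    (hS' : IsInitial α S') (hK : Γ.IsClique K) (hSK : S ⊆ K) (hSK' : S' ⊆ K) :
    S ⊆ S' ∨ S' ⊆ S := by
  by_contra! h
  obtain ⟨⟨a, ha, haS'⟩, b, hb, hbS⟩ := h.imp Set.not_subset.1 Set.not_subset.1
  rcases hα.adj_or (hK (hSK ha) (hSK' hb) fun hab => haS' (hab ▸ hb)) with hab | hba
  · exact haS' (hS' a b hab hb)
  · exact hbS (hS b a hba ha)

/-- `l` is a topological ordering of its elements: no edge of `α` goes from a later to an earlier
one. -/
def IsTopological (α : Digraph V) (l : List V) : Prop :=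
  l.Pairwise fun a b => ¬ α.Adj b a

theorem IsAcyclic.exists_isTopological [Finite V] (hα : IsAcyclic α) (S : Set V) :
    ∃ l : List V, IsPermOf l S ∧ IsTopological α l := by
  induction S using WellFoundedLT.induction with
  | _ S ih =>
  rcases S.eq_empty_or_nonempty with rfl | hne
  · exact ⟨[], ⟨List.nodup_nil, by simp only [List.not_mem_nil, Set.ofPred_false]⟩, .nil⟩
  obtain ⟨y, hy, hmin⟩ := hα.exists_source hne
  obtain ⟨l, hl, htop⟩ := ih (S \ {y}) (Set.sdiff_singleton_ssubset.2 hy)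
  refine ⟨y :: l, ⟨List.nodup_cons.2 ⟨fun h => (hl.mem_iff.1 h).2 rfl, hl.1⟩, ?_⟩,
    List.pairwise_cons.2 ⟨fun x hx => hmin x (hl.mem_iff.1 hx).1, htop⟩⟩
  rw [← Set.insert_sdiff_self_of_mem hy, ← hl.2]
  exact Set.ext fun x => List.mem_cons

theorem IsAMO.pairwise_adj_of_isTopological (hα : IsAMO Γ α) (hK : Γ.IsClique K)
    (hl : IsPermOf l K) (h : IsTopological α l) : l.Pairwise α.Adj :=
  (h.and hl.1).imp_of_mem fun ha hb hab =>
    (hα.adj_or (hK (hl.mem_iff.1 ha) (hl.mem_iff.1 hb) hab.2)).resolve_right hab.1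

theorem IsAMO.eq_of_isTopological (hα : IsAMO Γ α) (hK : Γ.IsClique K) {l' : List V}
    (hl : IsPermOf l K) (hl' : IsPermOf l' K) (h : IsTopological α l) (h' : IsTopological α l') :
    l = l' :=
  List.Perm.eq_of_pairwise (le := α.Adj) (fun _ _ _ _ hab hba => absurd hba (hα.not_adj_symm hab))
    (hα.pairwise_adj_of_isTopological hK hl h) (hα.pairwise_adj_of_isTopological hK hl' h')
    ((List.perm_ext_iff_of_nodup hl.1 hl'.1).2 fun _ => hl.mem_iff.trans hl'.mem_iff.symm)

theorem IsInitial.of_isPrefix (hK : IsInitial α K) {p : List V} (hl : IsPermOf l K)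
    (h : IsTopological α l) (hp : p <+: l) : IsInitial α {x | x ∈ p} := by
  obtain ⟨r, rfl⟩ := hp
  intro a b hab hb
  have ha : a ∈ p ++ r :=
    hl.mem_iff.2 (hK a b hab (hl.mem_iff.1 (List.mem_append_left _ hb)))
  exact (List.mem_append.1 ha).resolve_right fun har =>
    (List.pairwise_append.1 h).2.2 b hb a har hab

theorem IsInitial.exists_isPrefix (hα : IsAMO Γ α) (hK : Γ.IsClique K) (hSK : S ⊆ K)
    (hS : IsInitial α S) (hl : IsPermOf l K) (h : IsTopological α l) :
    ∃ p, p <+: l ∧ {x | x ∈ p} = S := by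
  have hadj := hα.pairwise_adj_of_isTopological hK hl h
  have hmem : ∀ x ∈ S, x ∈ l := fun x hx => hl.mem_iff.2 (hSK hx)
  clear hl h
  induction l using List.reverseRecOn with
  | nil =>
    exact ⟨[], List.prefix_rfl,
      Set.Subset.antisymm (fun _ hx => (List.not_mem_nil hx).elim) hmem⟩
  | append_singleton l a ih =>
    rw [List.pairwise_append] at hadj
    by_cases ha : a ∈ S
    · refine ⟨l ++ [a], List.prefix_rfl, Set.Subset.antisymm (fun x hx => ?_) hmem⟩
      rcases List.mem_append.1 hx with hx | hx
      · exact hS x a (hadj.2.2 x hx a (List.mem_singleton_self a)) ha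
      · exact List.mem_singleton.1 hx ▸ ha
    · obtain ⟨p, hp, hpS⟩ := ih hadj.1 fun x hx =>
        (List.mem_append.1 (hmem x hx)).resolve_right fun h => ha (List.mem_singleton.1 h ▸ hx)
      exact ⟨p, hp.trans (List.prefix_append _ _), hpS⟩

end Initial

section Forced

variable {V : Type*} {Γ : SimpleGraph V} {K : Set V} {α : Digraph V} {a b c : V}

/-- The orientations forced by the choice of the initial clique `K`: the edges leaving `K`, and
those that follow from `d → a - b` with `d`, `b` not adjacent. -/
inductive Forced (Γ : SimpleGraph V) (K : Set V) : V → V → Prop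
  | base {a b : V} : a ∈ K → b ∉ K → Γ.Adj a b → Forced Γ K a b
  | step {d a b : V} : Forced Γ K d a → Γ.Adj a b → d ≠ b → ¬ Γ.Adj d b → Forced Γ K a b

theorem Forced.graph_adj (h : Forced Γ K a b) : Γ.Adj a b := by
  cases h <;> assumption

theorem Forced.exists_nonadj (h : Forced Γ K a b) (ha : a ∉ K) :
    ∃ d, Forced Γ K d a ∧ d ≠ b ∧ ¬ Γ.Adj d b := by
  cases h with
  | base haK _ _ => exact absurd haK ha
  | step hda _ hdb hn => exact ⟨_, hda, hdb, hn⟩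

theorem Forced.adj (h : Forced Γ K a b) (hα : IsAMO Γ α) (hK : IsInitial α K) : α.Adj a b := by
  induction h with
  | base ha hb hab => exact (hα.adj_or hab).resolve_right fun h => hb (hK _ _ h ha)
  | step _ hab hdb hn ih =>
    exact (hα.adj_or hab).resolve_right fun h => hn (hα.adj_of_adj_of_adj hdb ih h)

/-- The edges outside `K` which are not forced. They turn out to be the undirected edges of
`H^K[V_H ∖ K]`. -/
def freeGraph (Γ : SimpleGraph V) (K : Set V) : SimpleGraph V where
  Adj a b := Γ.Adj a b ∧ a ∉ K ∧ b ∉ K ∧ ¬ Forced Γ K a b ∧ ¬ Forced Γ K b a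
  symm := ⟨fun _ _ h => ⟨h.1.symm, h.2.2.1, h.2.1, h.2.2.2.2, h.2.2.2.1⟩⟩
  loopless := ⟨fun _ h => Γ.loopless.irrefl _ h.1⟩

theorem freeGraph_le : freeGraph Γ K ≤ Γ :=
  fun _ _ h => h.1

theorem Forced.of_freeGraph_adj [Finite V] (hα : IsAMO Γ α) (hK : IsInitial α K)
    (h : Forced Γ K a b) (hbc : (freeGraph Γ K).Adj b c) : Forced Γ K a c := by
  induction a using hα.acyclic.wellFounded.transGen.induction generalizing b c with
  | _ a ih =>
  obtain ⟨hbcΓ, hbK, hcK, hnbc, hncb⟩ := hbc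
  have hac : Γ.Adj a c := by
    by_contra hn
    exact hnbc (h.step hbcΓ (by rintro rfl; exact hncb h) hn)
  by_contra hn
  have haK : a ∉ K := fun haK => hn (.base haK hcK hac)
  by_cases hca : Forced Γ K c a
  · obtain ⟨e, hec, hea, hnea⟩ := hca.exists_nonadj hcK
    have heb : Forced Γ K e b := ih e (.tail (.single (hec.adj hα hK)) (hca.adj hα hK)) hec
      ⟨hbcΓ.symm, hcK, hbK, hncb, hnbc⟩
    have hba : Forced Γ K b a := heb.step h.graph_adj.symm hea hnea
    exact hα.not_adj_symm (hba.adj hα hK) (h.adj hα hK)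
  · obtain ⟨d, hda, hdb, hndb⟩ := h.exists_nonadj haK
    have hdc : Forced Γ K d c := ih d (.single (hda.adj hα hK)) hda ⟨hac, haK, hcK, hn, hca⟩
    exact hncb (hdc.step hbcΓ.symm hdb hndb)

theorem Forced.of_reachable [Finite V] (hα : IsAMO Γ α) (hK : IsInitial α K)
    (h : Forced Γ K a b) (hbc : (freeGraph Γ K).Reachable b c) : Forced Γ K a c := by
  rw [SimpleGraph.reachable_iff_reflTransGen] at hbc
  induction hbc with
  | refl => exact h
  | tail _ hcd ih => exact ih.of_freeGraph_adj hα hK hcd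

theorem notMem_of_reachable_freeGraph (ha : a ∉ K) (h : (freeGraph Γ K).Reachable a b) :
    b ∉ K := by
  rw [SimpleGraph.reachable_iff_reflTransGen] at h
  rcases h.cases_tail with rfl | ⟨_, _, h⟩
  · exact ha
  · exact h.2.2.1

theorem freeGraph_adj_of_reachable [Finite V] (hα : IsAMO Γ α) (hK : IsInitial α K)
    (hab : Γ.Adj a b) (ha : a ∉ K) (h : (freeGraph Γ K).Reachable a b) :
    (freeGraph Γ K).Adj a b := by
  have hirr : ∀ x, ¬ Forced Γ K x x := fun _ hx => Γ.irrefl hx.graph_adj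
  exact ⟨hab, ha, notMem_of_reachable_freeGraph ha h,
    fun hf => hirr a (hf.of_reachable hα hK h.symm), fun hf => hirr b (hf.of_reachable hα hK h)⟩

theorem freeGraph_adj_of_adj_of_adj [Finite V] (hα : IsAMO Γ α) (hK : IsInitial α K)
    (hab : (freeGraph Γ K).Adj a b) (hcb : (freeGraph Γ K).Adj c b) (hac : Γ.Adj a c) :
    (freeGraph Γ K).Adj a c :=
  freeGraph_adj_of_reachable hα hK hac hab.2.1 (hab.reachable.trans hcb.symm.reachable)

theorem forced_of_adj (hα : IsAMO Γ α) (hK : IsInitial α K) (hab : α.Adj a b) (hb : b ∉ K)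
    (hn : ¬ (freeGraph Γ K).Adj a b) : Forced Γ K a b := by
  by_cases ha : a ∈ K
  · exact .base ha hb (hα.adj hab)
  · by_contra hf
    exact hn ⟨hα.adj hab, ha, hb, hf, fun h => hα.not_adj_symm hab (h.adj hα hK)⟩

theorem adj_of_reachable_freeGraph [Finite V] (hα : IsAMO Γ α) (hK : IsInitial α K)
    (hab : α.Adj a b) (hn : ¬ (freeGraph Γ K).Adj a b) (hbc : (freeGraph Γ K).Reachable b c) :
    α.Adj a c ∧ ¬ (freeGraph Γ K).Adj a c := by
  by_cases hb : b ∈ K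
  · rcases ((SimpleGraph.reachable_iff_reflTransGen b c).1 hbc).cases_head with rfl | ⟨_, h, _⟩
    · exact ⟨hab, hn⟩
    · exact absurd hb h.2.1
  · have hac : Forced Γ K a c := (forced_of_adj hα hK hab hb hn).of_reachable hα hK hbc
    exact ⟨hac.adj hα hK, fun h => h.2.2.2.1 hac⟩

end Forced

section Glue

variable {V : Type*} {Γ F : SimpleGraph V} {α γ : Digraph V} {K : Set V}

/-- The orientation that agrees with `γ` on the edges of `F` and with `α` on the others. -/
def glue (F : SimpleGraph V) (α γ : Digraph V) : Digraph V where
  Adj a b := γ.Adj a b ∨ (α.Adj a b ∧ ¬ F.Adj a b)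

theorem isAcyclic_glue [Finite V] (hα : IsAcyclic α) (hγ : IsAMO F γ)
    (hF : ∀ a b c, α.Adj a b → ¬ F.Adj a b → F.Reachable b c → α.Adj a c) :
    IsAcyclic (glue F α γ) := by
  refine isAcyclic_of_exists_source fun Y hY => ?_
  obtain ⟨y, hy, hmin⟩ := hα.exists_source hY
  obtain ⟨z, ⟨hz, hzy⟩, hzmin⟩ := hγ.acyclic.exists_source
    (Y := {z | z ∈ Y ∧ F.Reachable z y}) ⟨y, hy, .rfl⟩
  refine ⟨z, hz, ?_⟩
  rintro x hx (hxz | ⟨hxz, hn⟩)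
  · exact hzmin x ⟨hx, (hγ.adj hxz).reachable.trans hzy⟩ hxz
  · exact hmin x hx (hF x z y hxz hn hzy)

theorem isAMO_glue [Finite V] (hle : F ≤ Γ) (hα : IsAMO Γ α) (hγ : IsAMO F γ)
    (hF : ∀ a b c, α.Adj a b → ¬ F.Adj a b → F.Reachable b c → α.Adj a c) :
    IsAMO Γ (glue F α γ) := by
  refine isAMO_of_adj ?_ (fun a b hab => ?_) (isAcyclic_glue hα.acyclic hγ hF) ?_
  · rintro a b (hab | ⟨hab, -⟩)
    · exact hle (hγ.adj hab)
    · exact hα.adj hab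
  · by_cases h : F.Adj a b
    · exact (hγ.adj_or h).imp .inl .inl
    · exact (hα.adj_or hab).imp (fun hab => .inr ⟨hab, h⟩)
        fun hba => .inr ⟨hba, fun h' => h h'.symm⟩
  · rintro a b c hac (hab | ⟨hab, hn⟩) (hcb | ⟨hcb, hn'⟩)
    · exact hle (hγ.adj_of_adj_of_adj hac hab hcb)
    · exact (hα.adj (hF c b a hcb hn' (hγ.adj hab).symm.reachable)).symm
    · exact hα.adj (hF a b c hab hn (hγ.adj hcb).symm.reachable)
    · exact hα.adj_of_adj_of_adj hac hab hcb

theorem isAMO_glue_freeGraph [Finite V] (hα : IsAMO Γ α) (hK : IsInitial α K)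
    (hγ : IsAMO (freeGraph Γ K) γ) : IsAMO Γ (glue (freeGraph Γ K) α γ) :=
  isAMO_glue freeGraph_le hα hγ fun _ _ _ hab hn hbc =>
    (adj_of_reachable_freeGraph hα hK hab hn hbc).1

theorem isInitial_glue_freeGraph (hK : IsInitial α K) (hγ : IsAMO (freeGraph Γ K) γ) :
    IsInitial (glue (freeGraph Γ K) α γ) K := by
  rintro a b (hab | ⟨hab, -⟩) hb
  · exact absurd hb (hγ.adj hab).2.2.1
  · exact hK a b hab hb

theorem adj_iff_of_restrict_eq (h : restrict α F = restrict γ F) {a b : V} (hab : F.Adj a b) :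
    α.Adj a b ↔ γ.Adj a b := by
  have hiff : (restrict α F).Adj a b ↔ (restrict γ F).Adj a b := by rw [h]
  exact ⟨fun hα => (hiff.1 ⟨hα, hab⟩).1, fun hγ => (hiff.2 ⟨hγ, hab⟩).1⟩

theorem restrict_glue (hγ : IsAMO F γ) : restrict (glue F α γ) F = γ := by
  ext a b
  exact ⟨fun ⟨h, hab⟩ => h.resolve_right fun h => h.2 hab, fun h => ⟨.inl h, hγ.adj h⟩⟩

theorem IsEliminationRank.freeGraph [Finite V] {f : V → ℕ} (hf : IsEliminationRank Γ f)
    (hα : IsAMO Γ α) (hK : IsInitial α K) : IsEliminationRank (freeGraph Γ K) f where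
  ne_of_adj hab := hf.ne_of_adj hab.1
  adj_of_lt hac hab hcb hlt hlt' :=
    freeGraph_adj_of_adj_of_adj hα hK hab hcb (hf.adj_of_lt hac hab.1 hcb.1 hlt hlt')

end Glue

section AmosWithPrefix

variable {V : Type*} {Γ : SimpleGraph V} {α β γ : Digraph V} {K : Set V} {π : List V}

/-- The AMOs in which the vertices of `K` come first, in the order `π`. -/
def amosWithPrefix (Γ : SimpleGraph V) (K : Set V) (π : List V) : Set (Digraph V) :=
  {α | IsAMO Γ α ∧ IsInitial α K ∧ IsTopological α π}

theorem adj_of_mem_amosWithPrefix (hπ : IsPermOf π K) (hα : α ∈ amosWithPrefix Γ K π)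
    (hβ : β ∈ amosWithPrefix Γ K π) {a b : V} (hn : ¬ (freeGraph Γ K).Adj a b) (hab : α.Adj a b) :
    β.Adj a b := by
  obtain ⟨hα, hαK, hαπ⟩ := hα
  obtain ⟨hβ, hβK, hβπ⟩ := hβ
  by_cases hb : b ∈ K
  · have hnot : ∀ ⦃x⦄, x ∈ π → ∀ ⦃y⦄, y ∈ π → α.Adj x y → ¬ β.Adj y x := by
      refine List.Pairwise.forall_of_forall_of_flip
        (fun x _ hx => absurd (hα.adj hx) Γ.irrefl) (hβπ.imp ?_) (hαπ.imp ?_)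
      exacts [fun hn _ => hn, fun hn h => absurd h hn]
    exact (hβ.adj_or (hα.adj hab)).resolve_right
      (hnot (hπ.mem_iff.2 (hαK a b hab hb)) (hπ.mem_iff.2 hb) hab)
  · exact (forced_of_adj hα hαK hab hb hn).adj hβ hβK

theorem restrict_injOn_amosWithPrefix (hπ : IsPermOf π K) :
    Set.InjOn (restrict · (freeGraph Γ K)) (amosWithPrefix Γ K π) := by
  intro α hα β hβ (h : restrict α (freeGraph Γ K) = restrict β (freeGraph Γ K))
  ext a b
  by_cases hab : (freeGraph Γ K).Adj a b
  · exact adj_iff_of_restrict_eq h hab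
  · exact ⟨adj_of_mem_amosWithPrefix hπ hα hβ hab, adj_of_mem_amosWithPrefix hπ hβ hα hab⟩

theorem ncard_amosWithPrefix_eq_numAMO_freeGraph [Finite V] (hπ : IsPermOf π K)
    (hne : (amosWithPrefix Γ K π).Nonempty) :
    (amosWithPrefix Γ K π).ncard = numAMO (freeGraph Γ K) := by
  obtain ⟨α₀, hα₀, hα₀K, hα₀π⟩ := hne
  refine Set.BijOn.ncard_eq ⟨?_, restrict_injOn_amosWithPrefix hπ, ?_⟩
  · exact fun α hα => hα.1.restrict freeGraph_le fun _ _ _ =>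
      freeGraph_adj_of_adj_of_adj hα.1 hα.2.1
  · refine fun γ hγ => ⟨glue (freeGraph Γ K) α₀ γ, ⟨isAMO_glue_freeGraph hα₀ hα₀K hγ,
      isInitial_glue_freeGraph hα₀K hγ, ?_⟩, restrict_glue hγ⟩
    refine hα₀π.imp_of_mem fun {a b} ha _ hn => ?_
    rintro (hba | ⟨hba, -⟩)
    · exact (hγ.adj hba).2.2.1 (hπ.mem_iff.1 ha)
    · exact hn hba

end AmosWithPrefix

section FreeEdges

variable {V : Type*} [Finite V] {G : SimpleGraph V} {X K : Set V}

theorem IsChordal.amosWithPrefix_nonempty (hG : IsChordal G) (hKX : K ⊆ X) (hK : G.IsClique K)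
    {π : List V} (hπ : IsPermOf π K) : (amosWithPrefix (within G X) K π).Nonempty := by
  classical
  obtain ⟨f, hf, hfπ, hfK⟩ := hG.exists_isEliminationRank hKX hK (f₀ := π.idxOf)
    fun a ha b _ h => (List.idxOf_inj (hπ.mem_iff.2 ha)).1 h
  refine ⟨orientByRank (within G X) f, hf.isAMO_orientByRank, fun a b hab hb => ?_, ?_⟩
  · by_contra ha
    exact hab.2.not_gt (hfK b hb a hab.1.2.1 ha)
  · refine List.pairwise_iff_getElem.2 fun i j hi hj hij h => ?_
    have hlt : f π[j] < f π[i] := h.2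
    simp only [hfπ (hπ.mem_iff.1 (List.getElem_mem _)), hπ.1.idxOf_getElem] at hlt
    omega

theorem IsChordal.exists_isAMO_isInitial (hG : IsChordal G) (hKX : K ⊆ X) (hK : G.IsClique K) :
    ∃ α, IsAMO (within G X) α ∧ IsInitial α K := by
  obtain ⟨π, hπ⟩ := exists_isPermOf K
  obtain ⟨α, hα, hαK, -⟩ := hG.amosWithPrefix_nonempty hKX hK hπ
  exact ⟨α, hα, hαK⟩

theorem IsChordal.exists_adj_of_freeGraph_adj (hG : IsChordal G) (hKX : K ⊆ X)
    (hK : G.IsClique K) {a b : V} (hab : (freeGraph (within G X) K).Adj a b) :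
    ∃ α, IsAMO (within G X) α ∧ IsInitial α K ∧ α.Adj a b := by
  obtain ⟨α, hα, hαK⟩ := hG.exists_isAMO_isInitial hKX hK
  obtain ⟨f, hf, -, hfa⟩ := hG.exists_isEliminationRank (f₀ := 0)
    (Set.singleton_subset_iff.2 hab.1.2.1) (SimpleGraph.isClique_singleton a)
    (Set.injOn_singleton 0 a)
  have hlt : f a < f b := hfa a rfl b hab.1.2.2 hab.ne'
  have hγ := (hf.freeGraph hα hαK).isAMO_orientByRank
  exact ⟨_, isAMO_glue_freeGraph hα hαK hγ, isInitial_glue_freeGraph hαK hγ, .inl ⟨hab, hlt⟩⟩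

end FreeEdges

/-! ### The components of `H^K[V_H ∖ K]` -/

section Components

variable {V : Type*} {G : SimpleGraph V} {U C C' : G.Subgraph} {a b v : V}

/-- `C` is a connected component of `U`. -/
abbrev IsComponent (U C : G.Subgraph) : Prop :=
  Maximal (fun C' : G.Subgraph => C' ≤ U ∧ C'.Connected) C

theorem IsComponent.le_of_connected (hC : IsComponent U C) (hC' : C' ≤ U) (hconn : C'.Connected)
    (hv : v ∈ C.verts) (hv' : v ∈ C'.verts) : C' ≤ C :=
  le_sup_right.trans <| hC.le_of_ge ⟨sup_le hC.prop.1 hC',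
    SimpleGraph.Subgraph.connected_sup hC.prop.2.preconnected hconn.preconnected ⟨v, hv, hv'⟩⟩
    le_sup_left

theorem IsComponent.eq_of_mem (hC : IsComponent U C) (hC' : IsComponent U C') (hv : v ∈ C.verts)
    (hv' : v ∈ C'.verts) : C = C' :=
  (hC'.le_of_connected hC.prop.1 hC.prop.2 hv' hv).antisymm
    (hC.le_of_connected hC'.prop.1 hC'.prop.2 hv hv')

theorem IsComponent.adj_of_mem (hC : IsComponent U C) (ha : a ∈ C.verts) (hab : U.Adj a b) :
    C.Adj a b :=
  (hC.le_of_connected (SimpleGraph.subgraphOfAdj_le_of_adj U hab)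
    (SimpleGraph.Subgraph.subgraphOfAdj_connected hab.adj_sub) ha (.inl rfl)).2
    (Eq.refl s(a, b))

theorem exists_isComponent [Finite V] (hv : v ∈ U.verts) :
    ∃ C, IsComponent U C ∧ v ∈ C.verts := by
  obtain ⟨C, hvC, hC⟩ := Finite.exists_le_maximal
    (p := fun C' : G.Subgraph => C' ≤ U ∧ C'.Connected)
    ⟨(SimpleGraph.singletonSubgraph_le_iff v U).2 hv,
      SimpleGraph.Subgraph.singletonSubgraph_connected⟩
  exact ⟨C, hC, hvC.1 rfl⟩

/-- The union of orientations of the components of `U`. -/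
def unionOfComponents (U : G.Subgraph) (δ : {C // IsComponent U C} → Digraph V) : Digraph V where
  Adj a b := ∃ C, (δ C).Adj a b

theorem unionOfComponents_adj_iff {δ : {C // IsComponent U C} → Digraph V}
    (hδ : ∀ C, IsAMO C.1.spanningCoe (δ C)) (C : {C // IsComponent U C})
    (h : a ∈ C.1.verts ∨ b ∈ C.1.verts) :
    (unionOfComponents U δ).Adj a b ↔ (δ C).Adj a b := by
  refine ⟨?_, fun hab => ⟨C, hab⟩⟩
  rintro ⟨D, hab⟩
  have habD : D.1.Adj a b := (hδ D).adj hab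
  have hDC : D = C := Subtype.ext <| h.elim
    (D.2.eq_of_mem C.2 (D.1.edge_vert habD))
    (D.2.eq_of_mem C.2 (D.1.edge_vert habD.symm))
  exact hDC ▸ hab

theorem isAMO_unionOfComponents [Finite V] {δ : {C // IsComponent U C} → Digraph V}
    (hδ : ∀ C, IsAMO C.1.spanningCoe (δ C)) : IsAMO U.spanningCoe (unionOfComponents U δ) := by
  refine isAMO_of_adj ?_ (fun a b hab => ?_) (isAcyclic_of_exists_source fun Y ⟨y, hy⟩ => ?_) ?_
  · rintro a b ⟨C, hab⟩
    exact C.2.prop.1.2 ((hδ C).adj hab)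
  · obtain ⟨C, hC, ha⟩ := exists_isComponent (U.edge_vert hab)
    exact ((hδ ⟨C, hC⟩).adj_or (hC.adj_of_mem ha hab)).imp (⟨_, ·⟩) (⟨_, ·⟩)
  · by_cases hyU : y ∈ U.verts
    · obtain ⟨C, hC, hyC⟩ := exists_isComponent hyU
      obtain ⟨z, ⟨hz, hzC⟩, hmin⟩ :=
        (hδ ⟨C, hC⟩).acyclic.exists_source (Y := Y ∩ C.verts) ⟨y, hy, hyC⟩
      refine ⟨z, hz, fun x hx hxz => ?_⟩
      have hxz := (unionOfComponents_adj_iff hδ ⟨C, hC⟩ (.inr hzC)).1 hxz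
      exact hmin x ⟨hx, C.edge_vert ((hδ ⟨C, hC⟩).adj hxz)⟩ hxz
    · refine ⟨y, hy, ?_⟩
      rintro x - ⟨C, hxy⟩
      exact hyU (C.2.prop.1.1 (C.1.edge_vert ((hδ C).adj hxy).symm))
  · rintro a b c hac ⟨C, hab⟩ hcb
    have hcb := (unionOfComponents_adj_iff hδ C
      (.inr (C.1.edge_vert ((hδ C).adj hab).symm))).1 hcb
    exact C.2.prop.1.2 ((hδ C).adj_of_adj_of_adj hac hab hcb)

theorem IsComponent.isAMO_restrict {α : Digraph V} (hC : IsComponent U C)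
    (hα : IsAMO U.spanningCoe α) : IsAMO C.spanningCoe (restrict α C.spanningCoe) :=
  hα.restrict (SimpleGraph.Subgraph.spanningCoe_le_of_le hC.prop.1) fun _ _ _ hab _ hac =>
    hC.adj_of_mem (C.edge_vert hab) hac

theorem numAMO_eq_finprod_isComponent [Finite V] (U : G.Subgraph) :
    numAMO U.spanningCoe = ∏ᶠ (C) (_ : IsComponent U C), numAMO C.spanningCoe := by
  have := Fintype.ofFinite {C // IsComponent U C}
  let toComponents : {α | IsAMO U.spanningCoe α} →
      ∀ C : {C // IsComponent U C}, {δ | IsAMO C.1.spanningCoe δ} :=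
    fun α C => ⟨restrict α.1 C.1.spanningCoe, C.2.isAMO_restrict α.2⟩
  have hbij : toComponents.Bijective := by
    refine ⟨fun α β h => Subtype.ext ?_, fun δ => ?_⟩
    · ext a b
      suffices ∀ C : {C // IsComponent U C}, C.1.Adj a b → (α.1.Adj a b ↔ β.1.Adj a b) by
        by_cases hab : U.Adj a b
        · obtain ⟨C, hC, ha⟩ := exists_isComponent (U.edge_vert hab)
          exact this ⟨C, hC⟩ (hC.adj_of_mem ha hab)
        · exact ⟨fun h => absurd (α.2.adj h) hab, fun h => absurd (β.2.adj h) hab⟩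
      exact fun C hab => adj_iff_of_restrict_eq (congrArg Subtype.val (congrFun h C)) hab
    · refine ⟨⟨unionOfComponents U (fun C => (δ C).1),
        isAMO_unionOfComponents fun C => (δ C).2⟩, funext fun C => Subtype.ext ?_⟩
      ext a b
      refine ⟨fun ⟨hab, habC⟩ => ?_, fun hab => ⟨⟨C, hab⟩, (δ C).2.adj hab⟩⟩
      exact (unionOfComponents_adj_iff (fun C => (δ C).2) C (.inl (C.1.edge_vert habC))).1 hab
  rw [← finprod_subtype_eq_finprod_cond, finprod_eq_prod_of_fintype, numAMO,
    ← Nat.card_coe_set_eq, Nat.card_eq_of_bijective _ hbij, Nat.card_pi]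
  simp only [Nat.card_coe_set_eq, numAMO]

end Components

section UndirectedPart

variable {V : Type*} {G : SimpleGraph V} {H C : G.Subgraph} {K : Set V}

theorem lt_of_isComponent (hne : (K ∩ H.verts).Nonempty)
    (hC : IsComponent (undirectedPart H K) C) : C < H := by
  obtain ⟨k, hkK, hkH⟩ := hne
  refine lt_of_le_not_ge ⟨fun a ha => (hC.prop.1.1 ha).1, fun a b hab => ?_⟩
    fun h => (hC.prop.1.1 (h.1 hkH)).2 hkK
  exact cliqueOrientation_adj_sub H K (hC.prop.1.2 hab).2.2.1

variable [Finite V]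

theorem exists_represents_iff {α : Digraph V} (hα : IsAMO H.spanningCoe α) (hKH : K ⊆ H.verts)
    {π : List V} (hπ : IsPermOf π K) :
    (∃ τ, Represents H τ α ∧ π <+: τ) ↔ IsInitial α K ∧ IsTopological α π := by
  constructor
  · rintro ⟨τ, ⟨hτ, hτα⟩, hπτ⟩
    have hinit : IsInitial α H.verts := fun _ _ hab _ => H.edge_vert (hα.adj hab)
    exact ⟨hπ.2 ▸ hinit.of_isPrefix hτ hτα hπτ, hτα.sublist hπτ.sublist⟩
  · rintro ⟨hK, hπα⟩
    obtain ⟨σ, hσ, hσα⟩ := hα.acyclic.exists_isTopological (H.verts \ K)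
    refine ⟨π ++ σ, ⟨⟨List.nodup_append'.2 ⟨hπ.1, hσ.1, fun x hx hx' =>
      (hσ.mem_iff.1 hx').2 (hπ.mem_iff.1 hx)⟩, ?_⟩, List.pairwise_append.2 ⟨hπα, hσα,
      fun a ha b hb hba => (hσ.mem_iff.1 hb).2 (hK b a hba (hπ.mem_iff.1 ha))⟩⟩,
      List.prefix_append _ _⟩
    ext x
    rw [Set.mem_ofPred_eq, List.mem_append, hπ.mem_iff, hσ.mem_iff, ← Set.mem_union,
      Set.union_sdiff_cancel hKH]

theorem cliqueOrientation_adj_iff (hKH : K ⊆ H.verts) {a b : V} :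
    (cliqueOrientation H K).Adj a b ↔ ∃ α, IsAMO H.spanningCoe α ∧ IsInitial α K ∧ α.Adj a b := by
  constructor
  · rintro ⟨_, ⟨π, hπ, rfl⟩, α, ⟨hα, hτ⟩, hab⟩
    exact ⟨α, hα, ((exists_represents_iff hα hKH hπ).1 hτ).1, hab⟩
  · rintro ⟨α, hα, hK, hab⟩
    obtain ⟨π, hπ, hπα⟩ := hα.acyclic.exists_isTopological K
    exact ⟨_, ⟨π, hπ, rfl⟩, α, ⟨hα, (exists_represents_iff hα hKH hπ).2 ⟨hK, hπα⟩⟩, hab⟩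

theorem spanningCoe_undirectedPart (hG : IsChordal G) (hH : H.IsInduced) (hKH : K ⊆ H.verts)
    (hK : G.IsClique K) : (undirectedPart H K).spanningCoe = freeGraph (within G H.verts) K := by
  ext a b
  change _ ∧ _ ∧ _ ↔ _
  rw [cliqueOrientation_adj_iff hKH, cliqueOrientation_adj_iff hKH, spanningCoe_eq_within hH]
  constructor
  · rintro ⟨ha, hb, ⟨α, hα, hαK, hab⟩, β, hβ, hβK, hba⟩
    exact ⟨hα.adj hab, ha.2, hb.2, fun h => hβ.not_adj_symm hba (h.adj hβ hβK),
      fun h => hα.not_adj_symm hab (h.adj hα hαK)⟩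
  · intro hab
    exact ⟨⟨hab.1.2.1, hab.2.1⟩, ⟨hab.1.2.2, hab.2.2.1⟩,
      hG.exists_adj_of_freeGraph_adj hKH hK hab, hG.exists_adj_of_freeGraph_adj hKH hK hab.symm⟩

theorem isInduced_of_isComponent (hG : IsChordal G) (hH : H.IsInduced) (hKH : K ⊆ H.verts)
    (hK : G.IsClique K) (hC : IsComponent (undirectedPart H K) C) : C.IsInduced := by
  intro a ha b hb hab
  have haU : a ∈ H.verts \ K := hC.prop.1.1 ha
  have hbU : b ∈ H.verts \ K := hC.prop.1.1 hb
  have hreach : (undirectedPart H K).spanningCoe.Reachable a b :=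
    (hC.prop.2.preconnected.coe ⟨a, ha⟩ ⟨b, hb⟩).map ⟨Subtype.val, fun h => hC.prop.1.2 h⟩
  rw [spanningCoe_undirectedPart hG hH hKH hK] at hreach
  obtain ⟨α, hα, hαK⟩ := hG.exists_isAMO_isInitial hKH hK
  have hfree := freeGraph_adj_of_reachable hα hαK ⟨hab, haU.1, hbU.1⟩ haU.2 hreach
  rw [← spanningCoe_undirectedPart hG hH hKH hK] at hfree
  exact hC.adj_of_mem ha hfree

theorem ncard_amosWithPrefix (hG : IsChordal G) (hH : H.IsInduced) (hKH : K ⊆ H.verts)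
    (hK : G.IsClique K) {π : List V} (hπ : IsPermOf π K) :
    (amosWithPrefix (within G H.verts) K π).ncard =
      ∏ᶠ C ∈ components H K, numAMO C.spanningCoe := by
  rw [ncard_amosWithPrefix_eq_numAMO_freeGraph hπ (hG.amosWithPrefix_nonempty hKH hK hπ),
    ← spanningCoe_undirectedPart hG hH hKH hK, numAMO_eq_finprod_isComponent]
  rfl

end UndirectedPart

/-! ### Separators in clique trees -/

section TreePaths

variable {N : Type*} {t : SimpleGraph N} {a b c : N} {e : Sym2 N}

/-- The edges of the paths from `a` to `b`. -/
def pathEdges (t : SimpleGraph N) (a b : N) : Set (Sym2 N) :=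
  {e | ∃ p : t.Walk a b, p.IsPath ∧ e ∈ p.edges}

theorem mem_edges_of_mem_pathEdges (ht : t.IsTree) (he : e ∈ pathEdges t a b) (q : t.Walk a b) :
    e ∈ q.edges := by
  classical
  obtain ⟨p, hp, he⟩ := he
  have hpq : p = q.bypass := (ht.existsUnique_path a b).unique hp q.bypass_isPath
  exact q.edges_bypass_subset_edges (hpq ▸ he)

theorem pathEdges_triangle (ht : t.IsTree) (b : N) (he : e ∈ pathEdges t a c) :
    e ∈ pathEdges t a b ∨ e ∈ pathEdges t b c := by
  obtain ⟨p, hp⟩ := (ht.existsUnique_path a b).exists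
  obtain ⟨q, hq⟩ := (ht.existsUnique_path b c).exists
  have hpq := mem_edges_of_mem_pathEdges ht he (p.append q)
  rw [SimpleGraph.Walk.edges_append, List.mem_append] at hpq
  exact hpq.imp (⟨p, hp, ·⟩) (⟨q, hq, ·⟩)

theorem pathEdges_symm (he : e ∈ pathEdges t a b) : e ∈ pathEdges t b a := by
  obtain ⟨p, hp, he⟩ := he
  exact ⟨p.reverse, hp.reverse, by rwa [SimpleGraph.Walk.edges_reverse, List.mem_reverse]⟩

theorem mem_of_mem_pathEdges (ht : t.IsTree) {S : Set N} (hS : (t.induce S).Connected)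
    (ha : a ∈ S) (hb : b ∈ S) (he : e ∈ pathEdges t a b) {x : N} (hx : x ∈ e) : x ∈ S := by
  obtain ⟨p⟩ := hS.preconnected ⟨a, ha⟩ ⟨b, hb⟩
  let f : t.induce S →g t := (SimpleGraph.Embedding.induce S).toHom
  have h : e ∈ (p.map f).edges :=
    mem_edges_of_mem_pathEdges ht (a := f ⟨a, ha⟩) (b := f ⟨b, hb⟩) he _
  rw [SimpleGraph.Walk.edges_map, List.mem_map] at h
  obtain ⟨e', -, rfl⟩ := h
  obtain ⟨y, -, rfl⟩ := Sym2.mem_map.1 hx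
  exact y.2

theorem exists_first_edge {Q : Sym2 N → Prop} (p : t.Walk a b) (h : ∃ e ∈ p.edges, Q e) :
    ∃ x y, t.Adj x y ∧ Q s(x, y) ∧ ∃ q : t.Walk a x, ∀ e ∈ q.edges, ¬ Q e := by
  induction p with
  | nil =>
    obtain ⟨e, he, -⟩ := h
    exact (List.not_mem_nil he).elim
  | @cons a c b hac p ih =>
    simp only [SimpleGraph.Walk.edges_cons, List.exists_mem_cons_iff] at h
    by_cases hQ : Q s(a, c)
    · exact ⟨a, c, hac, hQ, .nil, fun e he => (List.not_mem_nil he).elim⟩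
    · obtain ⟨x, y, hxy, hQxy, q, hq⟩ := ih (h.resolve_left hQ)
      exact ⟨x, y, hxy, hQxy, .cons hac q, List.forall_mem_cons.2 ⟨hQ, hq⟩⟩

end TreePaths

section InitialCliques

variable {V : Type*} {G : SimpleGraph V} {X K L P Q Y : Set V} {α : Digraph V}

theorem IsInitial.insert_of_source (hα : IsAMO (within G X) α) (hQ : IsInitial α Q) {z : V}
    (hzQ : z ∉ Q) (hz : ∀ c ∈ Q, (within G X).Adj c z)
    (hsrc : ∀ a, α.Adj a z → a ∉ Q → ∃ c ∈ Q, ¬ G.Adj c a) : IsInitial α (insert z Q) := by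
  rintro a b hab (rfl | hb)
  · by_contra ha
    have haQ : a ∉ Q := fun h => ha (.inr h)
    obtain ⟨c, hc, hca⟩ := hsrc a hab haQ
    have hcb : α.Adj c b := (hα.adj_or (hz c hc)).resolve_right fun h => hzQ (hQ b c h hc)
    exact hca (hα.adj_of_adj_of_adj (fun h : c = a => haQ (h ▸ hc)) hcb hab).1
  · exact .inr (hQ a b hab hb)

variable [Finite V]

theorem IsInitial.exists_source_sdiff (hα : IsAcyclic α) (hK : IsInitial α K) (hKL : ¬ K ⊆ L) :
    ∃ a ∈ K \ L, ∀ x, α.Adj x a → x ∈ K ∩ L := by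
  obtain ⟨a, ⟨haK, haL⟩, hmin⟩ := hα.exists_source (Set.sdiff_nonempty.2 hKL)
  refine ⟨a, ⟨haK, haL⟩, fun x hx => ⟨hK x a hx haK, ?_⟩⟩
  by_contra hxL
  exact hmin x ⟨hK x a hx haK, hxL⟩ hx

/-- Outside `K ∩ L` the vertices `a` and `b` are sources, and each component has only one. -/
theorem IsInitial.exists_not_reachable_sdiff_inter (hα : IsAMO (within G X) α)
    (hK : IsInitial α K) (hL : IsInitial α L) (hKL : ¬ K ⊆ L) (hLK : ¬ L ⊆ K) :
    ∃ a ∈ K \ L, ∃ b ∈ L \ K, ¬ (within G (X \ (K ∩ L))).Reachable a b := by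
  obtain ⟨a, ha, hasrc⟩ := hK.exists_source_sdiff hα.acyclic hKL
  obtain ⟨b, hb, hbsrc⟩ := hL.exists_source_sdiff hα.acyclic hLK
  have hα' : IsAMO (within G (X \ (K ∩ L))) (restrict α (within G (X \ (K ∩ L)))) :=
    hα.restrict (within_mono Set.sdiff_subset) fun _ _ _ hab hcb hac =>
      ⟨hac.1, hab.2.1, hcb.2.1⟩
  refine ⟨a, ha, b, hb, fun hreach => ha.2 ?_⟩
  have hab : a = b := hα'.source_unique_of_reachable
    (fun x hx => hx.2.2.1.2 (hasrc x hx.1)) (fun x hx => hx.2.2.1.2 (hbsrc x hx.1).symm) hreach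
  exact hab ▸ hb.1

/-- The region `Y` is closed under common neighbours of `P` adjacent to a vertex of `Y ∖ P`, so a
maximal initial clique between `P` and `Y` can only be extended inside `Y`. -/
theorem exists_isInitial_isMaxCliqueWithin (hα : IsAMO (within G X) α) (hPY : P ⊆ Y) (hYX : Y ⊆ X)
    (hP : G.IsClique P) (hPini : IsInitial α P) (hne : ∃ z ∈ Y, z ∉ P ∧ ∀ c ∈ P, G.Adj c z)
    (hY : ∀ z ∈ Y, z ∉ P → ∀ p ∈ X, G.Adj z p → (∀ c ∈ P, G.Adj c p) → p ∈ Y) :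
    ∃ Q, IsMaxCliqueWithin G X Q ∧ IsInitial α Q ∧ P ⊂ Q ∧ Q ⊆ Y := by
  obtain ⟨Q, hPQ, ⟨hQY, hQ, hQini⟩, hQmax⟩ := Finite.exists_le_maximal
    (p := fun Q : Set V => Q ⊆ Y ∧ G.IsClique Q ∧ IsInitial α Q) ⟨hPY, hP, hPini⟩
  have hnone : ∀ z ∈ Y, z ∉ Q → ¬ ∀ c ∈ Q, G.Adj c z := by
    intro z₀ hz₀ hz₀Q hadj₀
    obtain ⟨z, ⟨hzY, hzQ, hadj⟩, hmin⟩ := hα.acyclic.exists_source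
      (Y := {z | z ∈ Y ∧ z ∉ Q ∧ ∀ c ∈ Q, G.Adj c z}) ⟨z₀, hz₀, hz₀Q, hadj₀⟩
    have hini : IsInitial α (insert z Q) := by
      refine hQini.insert_of_source hα hzQ
        (fun c hc => ⟨hadj c hc, hYX (hQY hc), hYX hzY⟩) fun a haz haQ => ?_
      by_contra! hca
      have haz' := hα.adj haz
      exact hmin a ⟨hY z hzY (fun h => hzQ (hPQ h)) a haz'.2.1 haz'.1.symm
        fun c hc => hca c (hPQ hc), haQ, hca⟩ haz
    exact hzQ (hQmax ⟨Set.insert_subset hzY hQY, hQ.insert fun c hc _ => (hadj c hc).symm, hini⟩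
      (Set.subset_insert _ _) (Set.mem_insert _ _))
  have hPQ' : P ⊂ Q := by
    refine hPQ.ssubset_of_ne ?_
    rintro rfl
    obtain ⟨z, hz, hzP, hadj⟩ := hne
    exact hnone z hz hzP hadj
  refine ⟨Q, ⟨⟨hQY.trans hYX, hQ⟩, fun K hK hQK w hw => ?_⟩, hQini, hPQ', hQY⟩
  by_contra hwQ
  obtain ⟨z, hzQ, hzP⟩ := Set.exists_of_ssubset hPQ'
  have hadj : ∀ c ∈ Q, G.Adj c w := fun c hc => hK.2 (hQK hc) hw fun h => hwQ (h ▸ hc)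
  exact hnone w (hY z (hQY hzQ) hzP w (hK.1 hw) (hadj z hzQ) fun c hc => hadj c (hPQ hc)) hwQ hadj

end InitialCliques

namespace RootedCliqueTree

section Separators

variable {V : Type*} {G : SimpleGraph V} {H : G.Subgraph} (T : RootedCliqueTree H)

/-- The intersection of the cliques at the ends of an edge. -/
def sep (e : Sym2 T.Node) : Set V := {v | ∀ x ∈ e, v ∈ T.ι x}

theorem sep_mk (x y : T.Node) : T.sep s(x, y) = T.ι x ∩ T.ι y := by
  ext v
  simp [sep]

theorem mem_FP_iff {v : T.Node} {S : Set V} :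
    S ∈ T.FP v ↔ S ⊆ T.ι v ∧ ∃ e ∈ pathEdges T.tree T.root v, S = T.sep e := by
  constructor
  · rintro ⟨p, hp, d, hd, rfl, hS⟩
    exact ⟨hS, d.edge, ⟨p, hp, List.mem_map_of_mem hd⟩, (T.sep_mk _ _).symm⟩
  · rintro ⟨hS, e, ⟨p, hp, he⟩, rfl⟩
    obtain ⟨d, hd, rfl⟩ := List.mem_map.1 he
    exact ⟨p, hp, d, hd, T.sep_mk _ _, hS⟩

theorem isMaxCliqueWithin (hH : H.IsInduced) (x : T.Node) :
    IsMaxCliqueWithin G H.verts (T.ι x) := by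
  have h := T.bijOn.mapsTo (Set.mem_univ x)
  rwa [maxCliques_eq hH] at h

theorem exists_node (hH : H.IsInduced) {K : Set V} (hK : IsMaxCliqueWithin G H.verts K) :
    ∃ x, T.ι x = K := by
  have h : K ∈ maxCliques H := by rwa [maxCliques_eq hH]
  obtain ⟨x, -, hx⟩ := T.bijOn.surjOn h
  exact ⟨x, hx⟩

theorem isClique_within (hH : H.IsInduced) (x : T.Node) :
    (within G H.verts).IsClique (T.ι x) := fun _ ha _ hb hab =>
  have h := (T.isMaxCliqueWithin hH x).prop
  ⟨h.2 ha hb hab, h.1 ha, h.1 hb⟩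

theorem eq_of_subset (hH : H.IsInduced) {x y : T.Node} (h : T.ι x ⊆ T.ι y) : x = y :=
  T.bijOn.injOn (Set.mem_univ x) (Set.mem_univ y)
    ((T.isMaxCliqueWithin hH x).eq_of_le (T.isMaxCliqueWithin hH y).prop h)

theorem mem_sep (hH : H.IsInduced) {a b : T.Node} {u : V} (ha : u ∈ T.ι a) (hb : u ∈ T.ι b)
    {e : Sym2 T.Node} (he : e ∈ pathEdges T.tree a b) : u ∈ T.sep e :=
  fun _ hx => mem_of_mem_pathEdges T.isTree
    (T.connected u ((T.isMaxCliqueWithin hH a).prop.1 ha)) ha hb he hx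

theorem reachable_of_mem_of_mem (hH : H.IsInduced) {S : Set V} {a : T.Node} {x y : V}
    (hx : x ∈ T.ι a) (hxS : x ∉ S) (hy : y ∈ T.ι a) (hyS : y ∉ S) :
    (within G (H.verts \ S)).Reachable x y := by
  have h := (T.isMaxCliqueWithin hH a).prop
  by_cases hxy : x = y
  · rw [hxy]
  · exact SimpleGraph.Adj.reachable ⟨h.2 hx hy hxy, ⟨h.1 hx, hxS⟩, h.1 hy, hyS⟩

theorem reachable_of_walk (hH : H.IsInduced) {S : Set V} {a b : T.Node} (p : T.tree.Walk a b)
    (hp : ∀ e ∈ p.edges, ¬ T.sep e ⊆ S) {x y : V} (hx : x ∈ T.ι a) (hxS : x ∉ S)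
    (hy : y ∈ T.ι b) (hyS : y ∉ S) : (within G (H.verts \ S)).Reachable x y := by
  induction p generalizing x with
  | nil => exact T.reachable_of_mem_of_mem hH hx hxS hy hyS
  | @cons a c b hac p ih =>
    rw [SimpleGraph.Walk.edges_cons, List.forall_mem_cons, sep_mk] at hp
    obtain ⟨u, hu, huS⟩ := Set.not_subset.1 hp.1
    exact (T.reachable_of_mem_of_mem hH hx hxS hu.1 huS).trans (ih hp.2 hu.2 huS hy)

theorem exists_sep_eq_inter [Finite V] (hH : H.IsInduced) {α : Digraph V}
    (hα : IsAMO (within G H.verts) α) {v w : T.Node} (hvw : v ≠ w) (hv : IsInitial α (T.ι v))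
    (hw : IsInitial α (T.ι w)) :
    ∃ e ∈ pathEdges T.tree v w, T.sep e = T.ι v ∩ T.ι w := by
  by_contra! hne
  obtain ⟨p, hp⟩ := (T.isTree.existsUnique_path v w).exists
  have hsep : ∀ e ∈ p.edges, ¬ T.sep e ⊆ T.ι v ∩ T.ι w := fun e he hsub =>
    have he' : e ∈ pathEdges T.tree v w := ⟨p, hp, he⟩
    hne e he' (hsub.antisymm fun u hu => T.mem_sep hH hu.1 hu.2 he')
  obtain ⟨a, ha, b, hb, hab⟩ := hv.exists_not_reachable_sdiff_inter hα hw
    (fun h => hvw (T.eq_of_subset hH h)) fun h => hvw (T.eq_of_subset hH h).symm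
  exact hab (T.reachable_of_walk hH p hsep ha.1 (fun h => ha.2 h.2) hb.1 fun h => hb.2 h.1)

end Separators

/-! ### The start clique of an orientation -/

section Start

variable {V : Type*} {G : SimpleGraph V} {H : G.Subgraph} (T : RootedCliqueTree H)
  {P : Set V} {u w : T.Node} {z : V} {α : Digraph V}

/-- The clique at `v` is initial in `α`, and no forbidden prefix of `v` is. The permutations counted
by `φ(ι(v), FP(v, T))` are those that begin an ordering representing such an `α`. -/
def IsStart (α : Digraph V) (v : T.Node) : Prop :=
  IsInitial α (T.ι v) ∧ ∀ S ∈ T.FP v, ¬ IsInitial α S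

theorem isStart_unique [Finite V] (hH : H.IsInduced) (hα : IsAMO (within G H.verts) α)
    {v : T.Node} (hv : T.IsStart α v) (hw : T.IsStart α w) : v = w := by
  by_contra hvw
  obtain ⟨e, he, hsep⟩ := T.exists_sep_eq_inter hH hα hvw hv.1 hw.1
  have hini : IsInitial α (T.sep e) := by
    rw [hsep]
    exact fun a b hab hb => ⟨hv.1 a b hab hb.1, hw.1 a b hab hb.2⟩
  rcases pathEdges_triangle T.isTree T.root he with h | h
  · exact hv.2 _ (T.mem_FP_iff.2 ⟨hsep ▸ Set.inter_subset_left, e, pathEdges_symm h, rfl⟩) hini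
  · exact hw.2 _ (T.mem_FP_iff.2 ⟨hsep ▸ Set.inter_subset_right, e, h, rfl⟩) hini

/-- The nodes whose clique contains `P` and which are not separated from the root by an edge with
separator `P`. -/
def uncutNodes (P : Set V) : Set T.Node :=
  {u | P ⊆ T.ι u ∧ ∀ e ∈ pathEdges T.tree T.root u, T.sep e ≠ P}

theorem mem_uncutNodes_of_mem_of_mem (hH : H.IsInduced) (hu : u ∈ T.uncutNodes P)
    (hPw : P ⊆ T.ι w) (hzu : z ∈ T.ι u) (hzw : z ∈ T.ι w) (hzP : z ∉ P) :
    w ∈ T.uncutNodes P := by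
  refine ⟨hPw, fun e he hsep => ?_⟩
  rcases pathEdges_triangle T.isTree u he with h | h
  · exact hu.2 e h hsep
  · exact hzP (hsep ▸ T.mem_sep hH hzu hzw h)

theorem exists_mem_uncutNodes (hH : H.IsInduced) {v : T.Node} (hP : P ∈ T.FP v) :
    ∃ x ∈ T.uncutNodes P, ∃ z ∈ T.ι x, z ∉ P := by
  obtain ⟨-, e, ⟨p, -, he⟩, hPe⟩ := T.mem_FP_iff.1 hP
  obtain ⟨x, y, hxy, hsep, q, hq⟩ :=
    exists_first_edge (Q := fun e => T.sep e = P) p ⟨e, he, hPe.symm⟩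
  rw [T.sep_mk] at hsep
  obtain ⟨z, hzx, hzy⟩ :=
    Set.not_subset.1 fun h => T.tree.ne_of_adj hxy (T.eq_of_subset hH h)
  exact ⟨x, ⟨hsep ▸ Set.inter_subset_left,
    fun e he => hq e (mem_edges_of_mem_pathEdges T.isTree he q)⟩, z, hzx, fun hz =>
    hzy (hsep.symm.subset hz).2⟩

variable [Finite V]

theorem exists_mem_uncutNodes_of_adj (hH : H.IsInduced) (hu : u ∈ T.uncutNodes P)
    (hz : z ∈ T.ι u) (hzP : z ∉ P) {p : V} (hp : p ∈ H.verts) (hzp : G.Adj z p)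
    (hPp : ∀ c ∈ P, G.Adj c p) : ∃ w ∈ T.uncutNodes P, p ∈ T.ι w := by
  have hmax := (T.isMaxCliqueWithin hH u).prop
  have hzPu : insert z P ⊆ T.ι u := Set.insert_subset hz hu.1
  have hclique : G.IsClique (insert p (insert z P)) :=
    SimpleGraph.IsClique.insert (hmax.2.subset hzPu) <| by
      rintro c (rfl | hc) -
      exacts [hzp.symm, (hPp c hc).symm]
  obtain ⟨K, hK, hle⟩ :=
    exists_isMaxCliqueWithin_ge (Set.insert_subset hp (hzPu.trans hmax.1)) hclique
  obtain ⟨w, rfl⟩ := T.exists_node hH hK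
  have hzPw : insert z P ⊆ T.ι w := (Set.subset_insert _ _).trans hle
  exact ⟨w, T.mem_uncutNodes_of_mem_of_mem hH hu ((Set.subset_insert _ _).trans hzPw) hz
    (hzPw (Set.mem_insert _ _)) hzP, hle (Set.mem_insert _ _)⟩

theorem exists_isInitial_mem_uncutNodes (hH : H.IsInduced) (hα : IsAMO (within G H.verts) α)
    {v : T.Node} (hP : P ∈ T.FP v) (hPini : IsInitial α P) :
    ∃ w ∈ T.uncutNodes P, IsInitial α (T.ι w) := by
  have hmax := fun u => (T.isMaxCliqueWithin hH u).prop
  have hadj : ∀ u ∈ T.uncutNodes P, ∀ z ∈ T.ι u, z ∉ P → ∀ c ∈ P, G.Adj c z :=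
    fun u hu z hz hzP c hc => (hmax u).2 (hu.1 hc) hz fun h => hzP (h ▸ hc)
  obtain ⟨x, hx, z₀, hz₀, hz₀P⟩ := T.exists_mem_uncutNodes hH hP
  obtain ⟨Q, hQmax, hQini, hPQ, hQY⟩ := exists_isInitial_isMaxCliqueWithin
    (Y := {z | ∃ u ∈ T.uncutNodes P, z ∈ T.ι u}) hα (fun c hc => ⟨x, hx, hx.1 hc⟩)
    (fun z ⟨u, _, hz⟩ => (hmax u).1 hz) ((hmax x).2.subset hx.1) hPini
    ⟨z₀, ⟨x, hx, hz₀⟩, hz₀P, hadj x hx z₀ hz₀ hz₀P⟩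
    fun z ⟨u, hu, hz⟩ hzP p hp hzp hPp =>
      T.exists_mem_uncutNodes_of_adj hH hu hz hzP hp hzp hPp
  obtain ⟨w, rfl⟩ := T.exists_node hH hQmax
  obtain ⟨z, hzw, hzP⟩ := Set.exists_of_ssubset hPQ
  obtain ⟨u, hu, hzu⟩ := hQY hzw
  exact ⟨w, T.mem_uncutNodes_of_mem_of_mem hH hu hPQ.subset hzu hzw hzP, hQini⟩

theorem exists_isInitial_of_mem_FP (hH : H.IsInduced) (hα : IsAMO (within G H.verts) α)
    {v : T.Node} (hP : P ∈ T.FP v) (hPini : IsInitial α P)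
    (hmin : ∀ S ∈ T.FP v, IsInitial α S → P.ncard ≤ S.ncard) :
    ∃ w, IsInitial α (T.ι w) ∧ ∀ S ∈ T.FP w, IsInitial α S → P.ncard < S.ncard := by
  obtain ⟨w, hw, hwini⟩ := T.exists_isInitial_mem_uncutNodes hH hα hP hPini
  have hPv := (T.mem_FP_iff.1 hP).1
  refine ⟨w, hwini, fun S hS hSini => ?_⟩
  obtain ⟨hSw, e, he, rfl⟩ := T.mem_FP_iff.1 hS
  have hne : T.sep e ≠ P := hw.2 e he
  by_contra! hcard
  have hSP : T.sep e ⊆ P :=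
    (IsInitial.subset_or_subset hα hSini hPini (T.isClique_within hH w) hSw hw.1).resolve_right
      fun h => hne (Set.eq_of_subset_of_ncard_le h hcard).symm
  rcases pathEdges_triangle T.isTree v he with h | h
  · exact hne (Set.eq_of_subset_of_ncard_le hSP
      (hmin _ (T.mem_FP_iff.2 ⟨hSP.trans hPv, e, h, rfl⟩) hSini))
  · exact hne (hSP.antisymm fun c hc => T.mem_sep hH (hPv hc) (hw.1 hc) h)

theorem exists_isInitial (hH : H.IsInduced) (hα : IsAMO (within G H.verts) α) :
    ∃ v, IsInitial α (T.ι v) := by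
  rcases H.verts.eq_empty_or_nonempty with hempty | ⟨z, hz⟩
  · refine ⟨T.root, fun a b hab _ => ?_⟩
    simpa [hempty] using (hα.adj hab).2.1
  · obtain ⟨K, hK, hKini, -⟩ := exists_isInitial_isMaxCliqueWithin hα (Set.empty_subset H.verts)
      subset_rfl SimpleGraph.isClique_empty (fun _ _ _ => False.elim)
      ⟨z, hz, id, fun _ => False.elim⟩ fun _ _ _ _ hp _ _ => hp
    obtain ⟨v, rfl⟩ := T.exists_node hH hK
    exact ⟨v, hKini⟩

theorem exists_isStart (hH : H.IsInduced) (hα : IsAMO (within G H.verts) α) :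
    ∃ v, T.IsStart α v := by
  have hlarge : ∀ k : ℕ, ∃ v, IsInitial α (T.ι v) ∧
      ∀ S ∈ T.FP v, IsInitial α S → k ≤ S.ncard := by
    intro k
    induction k with
    | zero =>
      obtain ⟨v, hv⟩ := T.exists_isInitial hH hα
      exact ⟨v, hv, fun _ _ _ => Nat.zero_le _⟩
    | succ k ih =>
      obtain ⟨v, hv, hvmin⟩ := ih
      by_cases! h : ∃ P ∈ T.FP v, IsInitial α P ∧ P.ncard = k
      · obtain ⟨P, hP, hPini, rfl⟩ := h
        exact T.exists_isInitial_of_mem_FP hH hα hP hPini hvmin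
      · exact ⟨v, hv, fun S hS hSini => (hvmin S hS hSini).lt_of_ne (h S hS hSini).symm⟩
  obtain ⟨v, hv, hmin⟩ := hlarge (Nat.card V + 1)
  exact ⟨v, hv, fun S hS hSini => (Set.ncard_le_card S).not_gt (hmin S hS hSini)⟩

end Start

end RootedCliqueTree

/-! ### The counting formula -/

section CountingFormula

variable {V : Type*} {G : SimpleGraph V} {H : G.Subgraph} {K : Set V}

/-- The product of the numbers of AMOs of the components in `𝒞_H(K)`. -/
noncomputable def componentProduct (H : G.Subgraph) (K : Set V) : ℕ :=
  ∏ᶠ C ∈ components H K, numAMO C.spanningCoe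

theorem Enumerates.prod_numAMO {comps : List G.Subgraph} (h : Enumerates comps (components H K)) :
    (comps.map fun C => numAMO C.spanningCoe).prod = componentProduct H K := by
  classical
  have hset : components H K = ↑comps.toFinset :=
    Set.ext fun C => (h.2 C).symm.trans List.mem_toFinset.symm
  rw [componentProduct, hset, finprod_mem_coe_finset, List.prod_toFinset _ h.1]

/-- The permutations of `S` without a prefix in `R`, which are counted by `φ(S, R)`. -/
def allowedPerms (S : Set V) (R : Set (Set V)) : Set (List V) :=
  {l | IsPermOf l S ∧ ∀ p, p <+: l → {x | x ∈ p} ∉ R}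

theorem RootedCliqueTree.isStart_of_mem_amosWithPrefix (T : RootedCliqueTree H) (hH : H.IsInduced)
    {v : T.Node} {π : List V} (hπ : π ∈ allowedPerms (T.ι v) (T.FP v)) {α : Digraph V}
    (hα : α ∈ amosWithPrefix (within G H.verts) (T.ι v) π) : T.IsStart α v := by
  refine ⟨hα.2.1, fun S hS hSini => ?_⟩
  obtain ⟨p, hp, rfl⟩ := IsInitial.exists_isPrefix hα.1 (T.isClique_within hH v)
    (T.mem_FP_iff.1 hS).1 hSini hπ.1 hα.2.2
  exact hπ.2 p hp hS

variable [Finite V]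

instance (T : RootedCliqueTree H) : Finite T.Node :=
  Finite.of_injective T.ι (Set.injOn_univ.1 T.bijOn.injOn)

theorem finite_allowedPerms (S : Set V) (R : Set (Set V)) : (allowedPerms S R).Finite := by
  have := Fintype.ofFinite V
  exact (List.finite_length_le V (Fintype.card V)).subset fun l hl => hl.1.1.length_le_card

theorem RootedCliqueTree.exists_mem_amosWithPrefix (T : RootedCliqueTree H) (hH : H.IsInduced)
    {α : Digraph V} (hα : IsAMO (within G H.verts) α) :
    ∃ v, ∃ π ∈ allowedPerms (T.ι v) (T.FP v),
      α ∈ amosWithPrefix (within G H.verts) (T.ι v) π := by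
  obtain ⟨v, hv, hFP⟩ := T.exists_isStart hH hα
  obtain ⟨π, hπ, htop⟩ := hα.acyclic.exists_isTopological (T.ι v)
  exact ⟨v, π, ⟨hπ, fun p hp hS => hFP _ hS (hv.of_isPrefix hπ htop hp)⟩, hα, hv, htop⟩

theorem RootedCliqueTree.bijective_amosWithPrefix (T : RootedCliqueTree H) (hH : H.IsInduced) :
    Function.Bijective
      (fun x => ⟨x.2.2.1, x.2.2.2.1⟩ : (Σ v : T.Node, Σ π : allowedPerms (T.ι v) (T.FP v),
        amosWithPrefix (within G H.verts) (T.ι v) π.1) → {α // IsAMO (within G H.verts) α}) := by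
  constructor
  · rintro ⟨v, π, α, hα⟩ ⟨w, σ, β, hβ⟩ h
    obtain rfl : α = β := congrArg Subtype.val h
    obtain rfl := T.isStart_unique hH hα.1 (T.isStart_of_mem_amosWithPrefix hH π.2 hα)
      (T.isStart_of_mem_amosWithPrefix hH σ.2 hβ)
    obtain rfl : π = σ := Subtype.ext
      (hα.1.eq_of_isTopological (T.isClique_within hH v) π.2.1 σ.2.1 hα.2.2 hβ.2.2)
    rfl
  · rintro ⟨α, hα⟩
    obtain ⟨v, π, hπ, hαπ⟩ := T.exists_mem_amosWithPrefix hH hα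
    exact ⟨⟨v, ⟨π, hπ⟩, α, hαπ⟩, rfl⟩

theorem RootedCliqueTree.numAMO_eq_sum (T : RootedCliqueTree H) [Fintype T.Node]
    (hG : IsChordal G) (hH : H.IsInduced) :
    numAMO H.spanningCoe =
      ∑ v : T.Node, phi (T.ι v) (T.FP v) * componentProduct H (T.ι v) := by
  have : Finite (Digraph V) := Finite.of_injective Digraph.Adj fun _ _ h => Digraph.ext h
  have (v : T.Node) : Finite (allowedPerms (T.ι v) (T.FP v)) := finite_allowedPerms _ _
  have (v : T.Node) := Fintype.ofFinite (allowedPerms (T.ι v) (T.FP v))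
  have hcount (v : T.Node) (π : allowedPerms (T.ι v) (T.FP v)) :
      Nat.card (amosWithPrefix (within G H.verts) (T.ι v) π.1) = componentProduct H (T.ι v) :=
    have hmax := (T.isMaxCliqueWithin hH v).prop
    (Nat.card_coe_set_eq _).trans (ncard_amosWithPrefix hG hH hmax.1 hmax.2 π.2.1)
  have hphi (v : T.Node) : Nat.card (allowedPerms (T.ι v) (T.FP v)) = phi (T.ι v) (T.FP v) :=
    Nat.card_coe_set_eq _
  rw [numAMO, spanningCoe_eq_within hH, ← Nat.card_coe_set_eq]
  refine (Nat.card_congr (Equiv.ofBijective _ (T.bijective_amosWithPrefix hH))).symm.trans ?_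
  simp only [Nat.card_sigma, hcount, Finset.sum_const, Finset.card_univ, smul_eq_mul,
    ← Nat.card_eq_fintype_card, hphi]

end CountingFormula

/-! ### Subtrees of a rooted tree -/

section Descendants

variable {N : Type*} {t : SimpleGraph N} {r v w c c' : N}

/-- The nodes below `v`, including `v`, in the tree with root `r`. -/
def descendants (t : SimpleGraph N) (r v : N) : Set N :=
  {w | t.dist r w = t.dist r v + t.dist v w}

theorem mem_descendants : w ∈ descendants t r v ↔ t.dist r w = t.dist r v + t.dist v w :=
  Iff.rfl

theorem descendants_root (t : SimpleGraph N) (r : N) : descendants t r r = Set.univ :=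
  Set.eq_univ_of_forall fun w => by rw [mem_descendants, SimpleGraph.dist_self, zero_add]

theorem descendants_subset_of_adj (ht : t.Connected) (hvc : t.Adj v c)
    (hc : t.dist r c = t.dist r v + 1) : descendants t r c ⊆ descendants t r v := by
  intro w hw
  rw [mem_descendants] at hw ⊢
  have hvw := ht.dist_triangle (u := v) (v := c) (w := w)
  have hrw := ht.dist_triangle (u := r) (v := v) (w := w)
  rw [SimpleGraph.dist_eq_one_iff_adj.2 hvc] at hvw
  omega

theorem exists_mem_descendants_of_ne (ht : t.Connected) (hw : w ∈ descendants t r v)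
    (hne : v ≠ w) : ∃ c, (t.Adj v c ∧ t.dist r c = t.dist r v + 1) ∧ w ∈ descendants t r c := by
  rw [mem_descendants] at hw
  obtain ⟨p, hp⟩ := ht.exists_walk_length_eq_dist v w
  obtain ⟨c, hvc, p, rfl⟩ := p.exists_eq_cons_of_ne hne
  rw [SimpleGraph.Walk.length_cons] at hp
  have hcw := SimpleGraph.dist_le p
  have hrc := ht.dist_triangle (u := r) (v := v) (w := c)
  have hrw := ht.dist_triangle (u := r) (v := c) (w := w)
  rw [SimpleGraph.dist_eq_one_iff_adj.2 hvc] at hrc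
  exact ⟨c, ⟨hvc, by omega⟩, mem_descendants.2 (by omega)⟩

theorem mem_descendants_iff (ht : t.Connected) :
    w ∈ descendants t r v ↔
      w = v ∨ ∃ c, (t.Adj v c ∧ t.dist r c = t.dist r v + 1) ∧ w ∈ descendants t r c := by
  refine ⟨fun h => or_iff_not_imp_left.2 fun hne =>
    exists_mem_descendants_of_ne ht h (Ne.symm hne), ?_⟩
  rintro (rfl | ⟨c, ⟨hvc, hc⟩, h⟩)
  · rw [mem_descendants, SimpleGraph.dist_self, add_zero]
  · exact descendants_subset_of_adj ht hvc hc h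

theorem notMem_descendants_of_lt (h : t.dist r v < t.dist r c) : v ∉ descendants t r c := by
  rw [mem_descendants]
  omega

theorem exists_isPath_snd_eq (ht : t.Connected) (hvc : t.Adj v c)
    (hc : t.dist r c = t.dist r v + 1) (hw : w ∈ descendants t r c) :
    ∃ p : t.Walk v w, p.IsPath ∧ p.snd = c := by
  obtain ⟨p, hp⟩ := ht.exists_walk_length_eq_dist c w
  have hvw := descendants_subset_of_adj ht hvc hc hw
  rw [mem_descendants] at hw hvw
  refine ⟨.cons hvc p, SimpleGraph.Walk.isPath_of_length_eq_dist _ ?_,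
    SimpleGraph.Walk.snd_cons p hvc⟩
  rw [SimpleGraph.Walk.length_cons]
  omega

theorem eq_of_mem_descendants (ht : t.IsTree) (hvc : t.Adj v c) (hc : t.dist r c = t.dist r v + 1)
    (hvc' : t.Adj v c') (hc' : t.dist r c' = t.dist r v + 1) (hw : w ∈ descendants t r c)
    (hw' : w ∈ descendants t r c') : c = c' := by
  obtain ⟨p, hp, rfl⟩ := exists_isPath_snd_eq ht.connected hvc hc hw
  obtain ⟨p', hp', rfl⟩ := exists_isPath_snd_eq ht.connected hvc' hc' hw'
  rw [(ht.existsUnique_path v w).unique hp hp']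

variable [Fintype N]

open Classical in
/-- The sum of `f` over the nodes below `v`: the value that `v` and the nodes reached from it
contribute to a traversal. -/
noncomputable def subtreeSum (t : SimpleGraph N) (r : N) (f : N → ℕ) (v : N) : ℕ :=
  ∑ w with w ∈ descendants t r v, f w

theorem subtreeSum_root (t : SimpleGraph N) (r : N) (f : N → ℕ) :
    subtreeSum t r f r = ∑ w, f w := by
  simp only [subtreeSum, descendants_root, Set.mem_univ, Finset.filter_true]

theorem subtreeSum_eq_add_sum (ht : t.IsTree) (f : N → ℕ) {children : List N}
    (hch : Enumerates children {c | t.Adj v c ∧ t.dist r c = t.dist r v + 1}) :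
    subtreeSum t r f v = f v + (children.map (subtreeSum t r f)).sum := by
  classical
  have hchild : ∀ c ∈ children.toFinset, t.Adj v c ∧ t.dist r c = t.dist r v + 1 :=
    fun c hc => (hch.2 c).1 (List.mem_toFinset.1 hc)
  have hset : ({w | w ∈ descendants t r v} : Finset N) =
      insert v (children.toFinset.biUnion fun c => {w | w ∈ descendants t r c}) := by
    ext w
    simp only [Finset.mem_filter_univ, Finset.mem_insert, Finset.mem_biUnion, List.mem_toFinset,
      mem_descendants_iff ht.connected (v := v), hch.2]
    rfl
  have hv : v ∉ children.toFinset.biUnion fun c => ({w | w ∈ descendants t r c} : Finset N) := by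
    simp only [Finset.mem_biUnion, Finset.mem_filter_univ, not_exists, not_and]
    exact fun c hc => notMem_descendants_of_lt (by have := (hchild c hc).2; omega)
  have hdisj : (children.toFinset : Set N).PairwiseDisjoint
      fun c => ({w | w ∈ descendants t r c} : Finset N) := fun c hc c' hc' hne =>
    Finset.disjoint_left.2 fun w hw hw' => hne <| eq_of_mem_descendants ht (hchild c hc).1
      (hchild c hc).2 (hchild c' hc').1 (hchild c' hc').2 (Finset.mem_filter_univ _ |>.1 hw)
      (Finset.mem_filter_univ _ |>.1 hw')
  rw [subtreeSum, hset, Finset.sum_insert hv, Finset.sum_biUnion hdisj,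
    ← List.sum_toFinset _ hch.1]
  rfl

end Descendants

/-! ### Correctness of the algorithm -/

section Algorithm

variable {V : Type*} {G : SimpleGraph V} {n : ℕ} {H : G.Subgraph}

/-- Every run from the state ends, and it ends by returning `n` from the outermost call. -/
inductive Succeeds (n : ℕ) : State G → Prop
  | done (memo : Memo G) : Succeeds n (.ret n [] memo)
  | step {s : State G} : (∃ s', Step s s') → (∀ s', Step s s' → Succeeds n s') → Succeeds n s

theorem Succeeds.not_infinite {s : State G} (h : Succeeds n s) :
    ¬ ∃ run : ℕ → State G, run 0 = s ∧ ∀ i, Step (run i) (run (i + 1)) := by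
  induction h with
  | done memo =>
    rintro ⟨run, h0, h⟩
    have hstep := h 0
    rw [h0] at hstep
    cases hstep
  | step _ _ ih =>
    rintro ⟨run, rfl, h⟩
    exact ih (run 1) (h 0) ⟨fun i => run (i + 1), rfl, fun i => h (i + 1)⟩

theorem Succeeds.eq_ret {s t : State G} (h : Succeeds n s)
    (hst : Relation.ReflTransGen Step s t) (ht : ∀ s', ¬ Step t s') :
    ∃ memo, t = .ret n [] memo := by
  induction h with
  | done memo =>
    rcases Relation.ReflTransGen.cases_head hst with rfl | ⟨s', hs', -⟩
    · exact ⟨memo, rfl⟩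
    · cases hs'
  | step hex _ ih =>
    rcases Relation.ReflTransGen.cases_head hst with rfl | ⟨s', hs', hst'⟩
    · obtain ⟨s', hs'⟩ := hex
      exact absurd hs' (ht s')
    · exact ih s' hs' hst'

/-- All results stored in the table are correct. -/
def Memo.Correct (memo : Memo G) : Prop :=
  ∀ C k, memo C = some k → k = numAMO C.spanningCoe

open Classical in
theorem Memo.Correct.update {memo : Memo G} (h : memo.Correct) (H : G.Subgraph) :
    Memo.Correct (Function.update memo H (some (numAMO H.spanningCoe))) := by
  intro C k hC
  by_cases hCH : C = H
  · rw [hCH, Function.update_self, Option.some_inj] at hC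
    rw [hCH, hC]
  · rw [Function.update_of_ne hCH] at hC
    exact h C k hC

/-- The state `s memo` succeeds for every correct table `memo`. -/
def SucceedsIfCorrect (n : ℕ) (s : Memo G → State G) : Prop :=
  ∀ memo : Memo G, memo.Correct → Succeeds n (s memo)

/-- The call `count H`, executed with a correct table, succeeds if returning the number of AMOs of
`H` with a correct table does. -/
def CallSucceeds (n : ℕ) (H : G.Subgraph) : Prop :=
  ∀ stack : List (LoopFrame G), SucceedsIfCorrect n (.ret (numAMO H.spanningCoe) stack) →
    SucceedsIfCorrect n (.call H stack)

theorem succeeds_forLoop {T : RootedCliqueTree H} {sum : ℕ} {Q : List T.Node} {v : T.Node}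
    {stack : List (LoopFrame G)} (todo : List G.Subgraph) (prod : ℕ)
    (hcall : ∀ C ∈ todo, CallSucceeds n C)
    (hcont : SucceedsIfCorrect n (.whileLoop ⟨H, T, sum + phi (T.ι v) (T.FP v) *
      (prod * (todo.map fun C => numAMO C.spanningCoe).prod), Q⟩ stack)) :
    SucceedsIfCorrect n (.forLoop ⟨⟨H, T, sum, Q⟩, v, prod, todo⟩ stack) := by
  induction todo generalizing prod with
  | nil =>
    intro memo hmemo
    refine .step ⟨_, .add⟩ fun s' hs' => ?_
    cases hs'
    rw [List.map_nil, List.prod_nil, mul_one] at hcont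
    exact hcont memo hmemo
  | cons C todo ih =>
    rw [List.forall_mem_cons] at hcall
    rw [List.map_cons, List.prod_cons, ← mul_assoc prod] at hcont
    intro memo hmemo
    refine .step ⟨_, .recurse⟩ fun s' hs' => ?_
    cases hs'
    refine hcall.1 _ (fun memo' hmemo' => .step ⟨_, .resume⟩ fun s' hs' => ?_) memo hmemo
    cases hs'
    exact ih _ hcall.2 hcont memo' hmemo'

theorem succeeds_whileLoop_nil {T : RootedCliqueTree H} {stack : List (LoopFrame G)}
    (hcont : SucceedsIfCorrect n (.ret (numAMO H.spanningCoe) stack)) :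
    SucceedsIfCorrect n (.whileLoop ⟨H, T, numAMO H.spanningCoe, []⟩ stack) := by
  intro memo hmemo
  refine .step ⟨_, .finish⟩ fun s' hs' => ?_
  cases hs'
  convert hcont _ (hmemo.update H)

theorem RootedCliqueTree.inter_verts_nonempty (T : RootedCliqueTree H) (hH : H.IsInduced)
    (hne : H.verts.Nonempty) (v : T.Node) : (T.ι v ∩ H.verts).Nonempty := by
  obtain ⟨x, hx⟩ := hne
  have hmax := T.isMaxCliqueWithin hH v
  rw [Set.inter_eq_left.2 hmax.prop.1, Set.nonempty_iff_ne_empty]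
  intro hempty
  exact Set.notMem_empty x <| hempty ▸ hmax.2
    (y := {x}) ⟨Set.singleton_subset_iff.2 hx, SimpleGraph.isClique_singleton x⟩
    (hempty ▸ Set.empty_subset _) rfl

theorem RootedCliqueTree.lt_of_mem_components (T : RootedCliqueTree H) (hH : H.IsInduced)
    {v : T.Node} {C : G.Subgraph} (hC : C ∈ components H (T.ι v)) : C < H := by
  have hC : IsComponent (undirectedPart H (T.ι v)) C := hC
  obtain ⟨x, hx⟩ := hC.prop.2.nonempty
  exact lt_of_isComponent (T.inter_verts_nonempty hH ⟨x, (hC.prop.1.1 hx).1⟩ v) hC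

variable [Finite V]

/-- Invariant of the `while` loop: `sum` and the contributions of the subtrees below the nodes in
the queue add up to the number of AMOs. The total size of these subtrees decreases. -/
theorem succeeds_whileLoop (T : RootedCliqueTree H) [Fintype T.Node]
    {stack : List (LoopFrame G)}
    (hcall : ∀ v, ∀ C ∈ components H (T.ι v), CallSucceeds n C)
    (hcont : SucceedsIfCorrect n (.ret (numAMO H.spanningCoe) stack)) (Q : List T.Node) (sum : ℕ)
    (hsum : sum + (Q.map (subtreeSum T.tree T.root fun v =>
      phi (T.ι v) (T.FP v) * componentProduct H (T.ι v))).sum = numAMO H.spanningCoe) :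
    SucceedsIfCorrect n (.whileLoop ⟨H, T, sum, Q⟩ stack) := by
  induction hm : (Q.map (subtreeSum T.tree T.root fun _ => 1)).sum using Nat.strong_induction_on
    generalizing Q sum with
  | _ m ih =>
  cases Q with
  | nil =>
    rw [List.map_nil, List.sum_nil, add_zero] at hsum
    exact hsum ▸ succeeds_whileLoop_nil hcont
  | cons v Q =>
    intro memo hmemo
    obtain ⟨children, hchildren⟩ := exists_enumerates {w | T.IsChild v w}
    obtain ⟨comps, hcomps⟩ := exists_enumerates (components H (T.ι v))
    refine .step ⟨_, .pop hchildren hcomps⟩ fun s' hs' => ?_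
    cases hs' with
    | @pop _ _ _ _ _ _ _ children hchildren comps hcomps =>
    have hsub := fun f => subtreeSum_eq_add_sum T.isTree (r := T.root) f hchildren
    refine succeeds_forLoop comps 1 (fun C hC => hcall v C ((hcomps.2 C).1 hC))
      (ih _ ?_ _ _ ?_ rfl) memo hmemo
    · rw [← hm, List.map_cons, List.sum_cons, hsub, List.map_append, List.sum_append]
      omega
    · rw [one_mul, hcomps.prod_numAMO, ← hsum, List.map_cons, List.sum_cons, hsub,
        List.map_append, List.sum_append]
      ring

theorem IsChordal.callSucceeds (hG : IsChordal G) (n : ℕ) (H : G.Subgraph) (hH : H.IsInduced) :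
    CallSucceeds n H := by
  induction H using WellFoundedLT.induction with
  | _ H ih =>
  intro stack hcont memo hmemo
  rcases hmH : memo H with _ | k
  · obtain ⟨T⟩ := hG.nonempty_rootedCliqueTree hH
    refine .step ⟨_, .start hmH T⟩ fun s' hs' => ?_
    cases hs' with
    | lookup h => exact absurd (hmH.symm.trans h) (Option.some_ne_none _).symm
    | start h T =>
    have := Fintype.ofFinite T.Node
    refine succeeds_whileLoop T (fun v C hC => ?_) hcont [T.root] 0 ?_ memo hmemo
    · have hmax := (T.isMaxCliqueWithin hH v).prop
      exact ih C (T.lt_of_mem_components hH hC) (isInduced_of_isComponent hG hH hmax.1 hmax.2 hC)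
    · rw [List.map_singleton, List.sum_singleton, subtreeSum_root, zero_add,
        T.numAMO_eq_sum hG hH]
  · refine .step ⟨_, .lookup hmH⟩ fun s' hs' => ?_
    cases hs' with
    | lookup h =>
      rw [hmemo H _ h]
      exact hcont memo hmemo
    | start h T => exact absurd (hmH.symm.trans h) (Option.some_ne_none _)

end Algorithm

end CliquePicking

theorem mainTheorem2_general {V : Type*} [Finite V] (G : SimpleGraph V)
    (hchordal : CliquePicking.IsChordal G) :
    CliquePicking.Returns G (CliquePicking.numAMO G) := by
  have hinit : CliquePicking.Succeeds (CliquePicking.numAMO G) (CliquePicking.State.init G) := by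
    refine hchordal.callSucceeds _ ⊤ (fun _ _ _ _ hab => hab) [] (fun memo _ => ?_) _
      fun C k h => absurd h (Option.some_ne_none k).symm
    rw [SimpleGraph.Subgraph.spanningCoe_top]
    exact .done memo
  exact ⟨hinit.not_infinite, fun s hs hstuck => hinit.eq_ret hs hstuck⟩

theorem mainTheorem2 {V : Type*} [Finite V] (G : SimpleGraph V) (hconn : G.Connected)
    (hchordal : CliquePicking.IsChordal G) :
    CliquePicking.Returns G (CliquePicking.numAMO G) :=
  mainTheorem2_general G hchordal
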